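/- **TASEP.** Let $\mathcal W=\{X\in\mathbb Z^{\mathbb N}: X(1)>X(2)>\cdots\}$ ($\mathbb N=\{1,2,\dots\}$). TASEP is the Markov process on $\mathcal W$ whose generator acts on bounded cylinder functions $f$ (functions of finitely many coordinates) by $$\mathcal L f(X)=\sum_{k\ge1}\mathbf 1_{X(k-1)-X(k)>1}\big[f(X(1),\dots,X(k)+1,\dots)-f(X)\big],\qquad X(0):=\infty ,$$ that is, a process with right-continuous paths such that $f(X_t)-\int_0^t\mathcal Lf(X_s)\,ds$ is a martingale for every bounded cylinder $f$. Fix $m$, labels $1\le n_1<\dots<n_m$ and $a\in\mathbb Z^m$, and put $F_t(X_0;a,n)=\mathbb P_{X_0}(X_t(n_j)>a_j,\ j=1,\dots,m)$ for $t\ge0$, $X_0\in\mathcal W$. **Kernels.** Let $\Gamma_0$ be the positively oriented circle $|w|=\tfrac12$, let $Q(x,y)=2^{-(x-y)}\mathbf 1_{x>y}$ on $\mathbb Z$, and $$\mathcal S_{-t,-n}(z_1,z_2)=\frac1{2\pi i}\oint_{\Gamma_0}\frac{(1-w)^n}{2^{z_2-z_1}w^{n+1+z_2-z_1}}e^{t(w-1/2)}\,dw,\qquad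 \bar{\mathcal S}_{-t,n}(z_1,z_2)=\frac1{2\pi i}\oint_{\Gamma_0}\frac{(1-w)^{z_2-z_1+n-1}}{2^{z_1-z_2}w^n}e^{t(w-1/2)}\,dw\quad(n\ge1).$$ Let $B_0,B_1,\dots$ be the random walk on $\mathbb Z$ with transition probabilities $Q$, let $\tau=\min\{k\ge0: B_k>X_0(k+1)\}$ (with $\min\emptyset=\infty$), and $$\bar{\mathcal S}^{\mathrm{epi}(X_0)}_{-t,n}(z_1,z_2)=\mathbb E_{B_0=z_1}\big[\bar{\mathcal S}_{-t,n-\tau}(B_\tau,z_2)\mathbf 1_{\tau<n}\big].$$ Define on $\{n_1,\dots,n_m\}\times\mathbb Z$ the kernel $$K_t(n_i,x;n_j,y)=-Q^{n_j-n_i}(x,y)\mathbf 1_{n_i<n_j}+\sum_{z\in\mathbb Z}\mathcal S_{-t,-n_i}(z,x)\,\bar{\mathcal S}^{\mathrm{epi}(X_0)}_{-t,n_j}(z,y),$$ and $\bar\chi_af(n_j,x)=f(n_j,x)\mathbf 1_{x\le a_j}$. The Fredholm determinant of a kernel $A$ on a countable set $I$ is $\det(I-A)_{\ell^2(I)}=\sum_{k\ge0}\frac{(-1)^k}{k!}\sum_{x_1,\dots,x_k\in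 I}\det[A(x_p,x_q)]_{p,q=1}^k$. **Theorem.** Among functions $G:[0,\infty)\times\mathcal W\to\mathbb R$ that are bounded on $[0,T]\times\mathcal W$ for every $T$ and depend on $X$ only through its first $N$ coordinates for some $N$ (not depending on $t$), the Kolmogorov backward equation $$\tfrac{d}{dt}G_t(X)=\mathcal L G_t(X)\quad(t\ge0,\ X\in\mathcal W),\qquad G_0(X)=\mathbf 1_{X(n_1)>a_1,\dots,X(n_m)>a_m}$$ (with a one-sided derivative at $t=0$) has exactly one solution. This solution is $F_t(X_0;a,n)$, and for all $t\ge0$ and $X_0\in\mathcal W$ it is given by $$F_t(X_0;a,n)=\det\big(I-\bar\chi_aK_t\bar\chi_a\big)_{\ell^2(\{n_1,\dots,n_m\}\times\mathbb Z)},$$ where the Fredholm expansion converges absolutely. -/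

import Mathlib

open MeasureTheory ProbabilityTheory
open scoped NNReal Topology Real

noncomputable section

namespace TASEP

/-! ### Configurations and the generator -/

/-- One-sided particle configurations `X(1) > X(2) > X(3) > ⋯` on `ℤ`. -/
abbrev Config : Type := {X : ℕ+ → ℤ // StrictAnti X}

/-- `X(k-1) - X(k) > 1`, with the convention `X(0) = ∞` (no condition if `k = 1`). -/
def CanJump (X : Config) (k : ℕ+) : Prop :=
  ∀ j : ℕ+, j + 1 = k → 1 < X.1 j - X.1 k

theorem strictAnti_update (X : Config) (k : ℕ+) (h : CanJump X k) :
    StrictAnti (Function.update X.1 k (X.1 k + 1)) := by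
  intro i j hij
  by_cases hj : j = k
  · subst hj
    have hi : i ≠ j := hij.ne
    obtain ⟨p, rfl⟩ : ∃ p : ℕ+, p + 1 = j :=
      ⟨j - 1, PNat.sub_add_of_lt (lt_of_le_of_lt (one_le) hij)⟩
    have h1 := h p rfl
    have h2 : X.1 p ≤ X.1 i := X.2.antitone (PNat.lt_add_one_iff.1 hij)
    simp only [Function.update_self, Function.update_of_ne hi]
    lia
  · by_cases hi : i = k
    · subst hi
      have := X.2 hij
      simp only [Function.update_self, Function.update_of_ne hj]
      lia
    · simpa [Function.update_of_ne hj, Function.update_of_ne hi] using X.2 hij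

open Classical in
/-- The configuration after an attempted jump of particle `k`: it moves one step to the right
if that site is free, and nothing happens otherwise. -/
def jump (X : Config) (k : ℕ+) : Config :=
  if h : CanJump X k then ⟨Function.update X.1 k (X.1 k + 1), strictAnti_update X k h⟩ else X

/-- `f` depends on finitely many coordinates only. -/
def IsCylinder (f : Config → ℝ) : Prop :=
  ∃ N : ℕ+, ∀ X Y : Config, (∀ k ≤ N, X.1 k = Y.1 k) → f X = f Y

/-- The generator of TASEP,
`L f (X) = ∑_k 1{X(k-1) - X(k) > 1} [f(…, X(k)+1, …) - f(X)]`; the terms of blocked particles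
vanish because `jump X k = X`. For a cylinder function only finitely many terms are non-zero. -/
def gen (f : Config → ℝ) (X : Config) : ℝ :=
  ∑ᶠ k : ℕ+, (f (jump X k) - f X)

/-! ### The process and the backward equation -/

/-- `X` is (a version with right-continuous paths of) TASEP started from `x₀`, i.e. a solution of
the martingale problem for the generator on bounded cylinder functions. -/
structure IsTASEP {Ω : Type*} [mΩ : MeasurableSpace Ω] (P : Measure Ω)
    (ℱ : Filtration ℝ≥0 mΩ) (x₀ : Config) (X : ℝ≥0 → Ω → Config) : Prop where
  adapted : ∀ t, Measurable[ℱ t] (X t)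
  initial : ∀ᵐ ω ∂P, X 0 ω = x₀
  right_continuous : ∀ (ω : Ω) (k : ℕ+) (t : ℝ≥0),
    ∀ᶠ s in 𝓝[>] t, (X s ω).1 k = (X t ω).1 k
  martingale : ∀ f : Config → ℝ, IsCylinder f → (∃ C, ∀ x, |f x| ≤ C) →
    Martingale
      (fun (t : ℝ≥0) (ω : Ω) =>
        f (X t ω) - ∫ s in (0 : ℝ)..(t : ℝ), gen f (X s.toNNReal ω)) ℱ P

open Classical in
/-- `G` is a bounded solution, depending on finitely many particles, of the Kolmogorov backward
equation `d/dt G = L G`, `t ≥ 0`, with initial condition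
`G_0(X) = 1{X(n_1) > a_1, …, X(n_m) > a_m}`. -/
structure IsBackwardSolution {m : ℕ} (n : Fin m → ℕ+) (a : Fin m → ℤ)
    (G : ℝ → Config → ℝ) : Prop where
  cylinder : ∃ N : ℕ+, ∀ t, 0 ≤ t → ∀ X Y : Config,
    (∀ k ≤ N, X.1 k = Y.1 k) → G t X = G t Y
  bounded : ∀ T : ℝ, ∃ C : ℝ, ∀ t, 0 ≤ t → t ≤ T → ∀ X, |G t X| ≤ C
  equation : ∀ t, 0 ≤ t → ∀ X,
    HasDerivWithinAt (fun s => G s X) (gen (G t) X) (Set.Ici 0) t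
  initial : ∀ X, G 0 X = if ∀ j, a j < X.1 (n j) then 1 else 0

/-! ### Kernels on `ℤ` -/

/-- Composition of kernels. -/
def comp (A B : ℤ → ℤ → ℂ) (x y : ℤ) : ℂ := ∑' z, A x z * B z y

/-- `Q(x,y) = 2^{-(x-y)} 1{x > y}`. -/
def Q (x y : ℤ) : ℂ := if y < x then 1 / 2 ^ (x - y) else 0

/-- The powers `Q^k`, `k ≥ 0`. -/
def Qpow : ℕ → ℤ → ℤ → ℂ
  | 0 => fun x y => if x = y then 1 else 0
  | k + 1 => comp Q (Qpow k)

/-- The kernel `S_{-t,-n}`; the circle encloses the pole at `0` but not the point `1`. -/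
def S (t : ℝ) (n : ℕ) (z₁ z₂ : ℤ) : ℂ :=
  (2 * π * Complex.I)⁻¹ * ∮ w in C(0, 1 / 2),
    (1 - w) ^ n / (2 ^ (z₂ - z₁) * w ^ ((n : ℤ) + 1 + z₂ - z₁)) * Complex.exp (t * (w - 1 / 2))

/-- The kernel `S̄_{-t,n}`, `n ≥ 1`; the circle encloses `0` but not `1`. -/
def Sbar (t : ℝ) (n : ℕ) (z₁ z₂ : ℤ) : ℂ :=
  (2 * π * Complex.I)⁻¹ * ∮ w in C(0, 1 / 2),
    (1 - w) ^ (z₂ - z₁ + n - 1) / (2 ^ (z₁ - z₂) * w ^ n) * Complex.exp (t * (w - 1 / 2))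

/-! ### The random walk with transition probabilities `Q` -/

/-- Law of an i.i.d. sequence `ω` with `P(ω_i = r) = 2^{-(r+1)}`, `r ≥ 0`. -/
def walkLaw : Measure (ℕ → ℕ) :=
  Measure.infinitePi fun _ => geometricMeasure ⟨1 / 2, by norm_num, by norm_num⟩

/-- The walk `B_k` started at `z`, with downward steps `ω_i + 1 ≥ 1`. -/
def walk (z : ℤ) (ω : ℕ → ℕ) (k : ℕ) : ℤ := z - ∑ i ∈ Finset.range k, ((ω i : ℤ) + 1)

/-- The hitting time `τ = min {k ≥ 0 : B_k > X(k+1)}` of the strict epigraph of the curve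
`k ↦ X(k+1)` (and `τ = ∞` if there is no such `k`). -/
def hitTime (X : Config) (z : ℤ) (ω : ℕ → ℕ) : ℕ∞ :=
  ⨅ (k : ℕ) (_ : X.1 k.succPNat < walk z ω k), (k : ℕ∞)

open Classical in
/-- `S̄^{epi(X)}_{-t,n}(z₁,z₂) = E_{B_0 = z₁} [S̄_{-t,n-τ}(B_τ, z₂) 1{τ < n}]`. -/
def Sepi (X : Config) (t : ℝ) (n : ℕ) (z₁ z₂ : ℤ) : ℂ :=
  ∫ ω, (if hitTime X z₁ ω < n then
      Sbar t (n - (hitTime X z₁ ω).toNat) (walk z₁ ω (hitTime X z₁ ω).toNat) z₂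
    else 0) ∂walkLaw

/-! ### The TASEP kernel and Fredholm determinants -/

/-- `K_t(n_i,x;n_j,y) = -Q^{n_j-n_i}(x,y) 1{n_i<n_j} + (S_{-t,-n_i})^* S̄^{epi(X)}_{-t,n_j} (x,y)`,
with `(i,x)` standing for the point `(n_i,x)`. -/
def K {m : ℕ} (n : Fin m → ℕ+) (X : Config) (t : ℝ) (p q : Fin m × ℤ) : ℂ :=
  -(if n p.1 < n q.1 then Qpow ((n q.1 : ℕ) - (n p.1 : ℕ)) p.2 q.2 else 0)
    + comp (fun x y => S t (n p.1) y x) (Sepi X t (n q.1)) p.2 q.2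

/-- The kernel `χ̄_a A χ̄_a`, where `χ̄_a f(n_j,x) = f(n_j,x) 1{x ≤ a_j}`. -/
def cutoff {m : ℕ} (a : Fin m → ℤ) (A : Fin m × ℤ → Fin m × ℤ → ℂ) (p q : Fin m × ℤ) : ℂ :=
  if p.2 ≤ a p.1 ∧ q.2 ≤ a q.1 then A p q else 0

/-- `d` is the Fredholm determinant `det(I - A)` on `ℓ²(ι)`: the Fredholm expansion
`∑_k ((-1)^k / k!) ∑_{x_1,…,x_k ∈ ι} det [A(x_p,x_q)]_{p,q ≤ k}`, written as a sum over the finite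
subsets `{x_1,…,x_k}` of `ι`, converges unconditionally to `d`. -/
def HasFredholmDet {ι : Type*} [DecidableEq ι] (A : ι → ι → ℂ) (d : ℂ) : Prop :=
  HasSum (fun s : Finset ι => (-1) ^ s.card * (Matrix.of fun p q : s => A p q).det) d

end TASEP

end

/-!
A walk with transition probabilities `Q` hits the curve `k ↦ X(k+1)` at time `k` either above or
exactly at the height `X(k+1) + 1`. Raising the curve by one at this point, that is, letting a
particle jump, thus changes the hitting kernel `Sepi` by a kernel of rank one; if the particle is
blocked, the walk has hit the curve before and nothing changes (`epi_raise_of_blocked`). Recursion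
over the first step of the walk shows that the sum of these changes is the difference operator
`½ [Sepi(z - 1, y) - Sepi(z, y + 1)]` (`sum_epi_raise_sub`), and the contour integrals show that
the time derivative of `S^* Sepi` is given by the same operator. So every entry of `K` solves the
backward equation, with rank one terms. A determinant is affine along rank one perturbations, hence
every minor of `K` also solves the backward equation (`hasDerivAt_det_of_rankOne`).

The Fredholm expansion is a finite sum: far to the left, `K` consists of the powers of `Q` only, which
are strictly triangular in the labels, so a minor with an index there has a zero row
(`minor_cutoff_eq_zero`). At time `0` the operator `actS` is a power of `Q⁻¹`. If every
`a j < X(n j)`, the cutoff kernel is strictly triangular in the labels and the determinant is `1`;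
otherwise, for the largest `j` with `X(n j) ≤ a j`, the column of the kernel at `(j, X(n j))` is a unit
vector, and the minors cancel in pairs (`fredholm_zero`).

Uniqueness, the bound on the determinant, its reality and the identification with the process are all
obtained from one estimate on hierarchies `u_k' = u_{k+1}` (`norm_le_of_hasDeriv_succ`), applied to
the iterates of the generator. For the determinant it needs a bound above a fixed configuration
only, as the particles move to the right. For the process, `u_k(t)` is the expectation of the `k`-th
iterate of the generator on the initial datum, which is differentiable by the martingale property.
-/

noncomputable section

namespace TASEP

/-! ### Contour integrals -/

/-- `(2πi)⁻¹ ∮ (1 - w)^p w^{-q} e^{t(w - 1/2)} dw` over `|w| = 1/2`. Both kernels `S` and `Sbar` are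
powers of two times such an integral. -/
def contour (t : ℝ) (p q : ℤ) : ℂ :=
  (2 * π * Complex.I)⁻¹ * ∮ w in C(0, 1 / 2),
    (1 - w) ^ p / w ^ q * Complex.exp (t * (w - 1 / 2))

theorem ne_zero_of_mem_sphere {w : ℂ} (hw : w ∈ Metric.sphere (0 : ℂ) (1 / 2)) : w ≠ 0 := by
  rintro rfl
  simp at hw

theorem one_sub_ne_zero_of_mem_closedBall {w : ℂ} (hw : w ∈ Metric.closedBall (0 : ℂ) (1 / 2)) :
    1 - w ≠ 0 := by
  intro h
  have : w = 1 := by linear_combination -h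
  subst this
  norm_num at hw

theorem continuousOn_contour_integrand (t : ℝ) (p q : ℤ) :
    ContinuousOn (fun w : ℂ => (1 - w) ^ p / w ^ q * Complex.exp (t * (w - 1 / 2)))
      (Metric.sphere (0 : ℂ) (1 / 2)) := by
  have h1 : ContinuousOn (fun w : ℂ => (1 - w) ^ p) (Metric.sphere (0 : ℂ) (1 / 2)) :=
    (by fun_prop : ContinuousOn (fun w : ℂ => 1 - w) _).zpow₀ p fun w hw =>
      Or.inl (one_sub_ne_zero_of_mem_closedBall (Metric.sphere_subset_closedBall hw))
  have h2 : ContinuousOn (fun w : ℂ => w ^ q) (Metric.sphere (0 : ℂ) (1 / 2)) :=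
    continuousOn_id.zpow₀ q fun w hw => Or.inl (ne_zero_of_mem_sphere hw)
  exact (h1.div h2 fun w hw => zpow_ne_zero _ (ne_zero_of_mem_sphere hw)).mul (by fun_prop)

theorem contour_succ_left (t : ℝ) (p q : ℤ) :
    contour t (p + 1) q = contour t p q - contour t p (q - 1) := by
  unfold contour
  rw [← mul_sub, ← circleIntegral.integral_sub
    ((continuousOn_contour_integrand t p q).circleIntegrable (by norm_num))
    ((continuousOn_contour_integrand t p (q - 1)).circleIntegrable (by norm_num))]
  congr 1
  refine circleIntegral.integral_congr (by norm_num) fun w hw => ?_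
  have h0 := ne_zero_of_mem_sphere hw
  have h1 := one_sub_ne_zero_of_mem_closedBall (Metric.sphere_subset_closedBall hw)
  simp only [zpow_add_one₀ h1, zpow_sub_one₀ h0]
  field_simp

theorem hasDerivAt_contour (t : ℝ) (p q : ℤ) :
    HasDerivAt (fun t => contour t p q) (contour t p (q - 1) - 1 / 2 * contour t p q) t := by
  have key : HasDerivAt
      (fun t : ℝ => ∮ w in C(0, 1 / 2), (1 - w) ^ p / w ^ q * Complex.exp (t * (w - 1 / 2)))
      (∮ w in C(0, 1 / 2), (w - 1 / 2) * ((1 - w) ^ p / w ^ q * Complex.exp (t * (w - 1 / 2)))) t := by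
    have hc : ∀ s : ℝ, Continuous fun θ : ℝ =>
        (1 - circleMap 0 (1 / 2) θ) ^ p / circleMap 0 (1 / 2) θ ^ q *
          Complex.exp (s * (circleMap 0 (1 / 2) θ - 1 / 2)) := fun s =>
      (continuousOn_contour_integrand s p q).comp_continuous (continuous_circleMap _ _)
        fun θ => circleMap_mem_sphere _ (by norm_num) _
    have hd : Continuous (deriv (circleMap 0 (1 / 2))) := by
      have : deriv (circleMap 0 (1 / 2)) = fun θ => circleMap 0 (1 / 2) θ * Complex.I := by
        ext θ; simp
      rw [this]
      exact (continuous_circleMap _ _).mul continuous_const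
    obtain ⟨C, hC⟩ := (isCompact_Icc.prod isCompact_uIcc :
        IsCompact (Set.Icc (t - 1) (t + 1) ×ˢ Set.uIcc 0 (2 * π))).exists_bound_of_continuousOn
      (f := fun x : ℝ × ℝ => deriv (circleMap 0 (1 / 2)) x.2 •
        ((circleMap 0 (1 / 2) x.2 - 1 / 2) *
        ((1 - circleMap 0 (1 / 2) x.2) ^ p / circleMap 0 (1 / 2) x.2 ^ q *
          Complex.exp (x.1 * (circleMap 0 (1 / 2) x.2 - 1 / 2))))) (by
        have h0 : Continuous fun x : ℝ × ℝ => (1 - circleMap 0 (1 / 2) x.2) ^ p /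
            circleMap 0 (1 / 2) x.2 ^ q * Complex.exp ((0 : ℝ) * (circleMap 0 (1 / 2) x.2 - 1 / 2)) :=
          (hc 0).comp continuous_snd
        simp only [Complex.ofReal_zero, zero_mul, Complex.exp_zero, mul_one] at h0
        have h2 : Continuous fun x : ℝ × ℝ => circleMap 0 (1 / 2) x.2 :=
          (continuous_circleMap _ _).comp continuous_snd
        have h3 : Continuous fun x : ℝ × ℝ => deriv (circleMap 0 (1 / 2)) x.2 :=
          hd.comp continuous_snd
        refine Continuous.continuousOn ?_
        refine h3.smul ((h2.sub continuous_const).mul (h0.mul ?_))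
        fun_prop)
    refine (intervalIntegral.hasDerivAt_integral_of_dominated_loc_of_deriv_le
      (s := Metric.ball t 1) (bound := fun _ => C) (Metric.ball_mem_nhds t one_pos)
      (F := fun (s : ℝ) θ => deriv (circleMap 0 (1 / 2)) θ •
        ((1 - circleMap 0 (1 / 2) θ) ^ p / circleMap 0 (1 / 2) θ ^ q *
          Complex.exp (s * (circleMap 0 (1 / 2) θ - 1 / 2))))
      (F' := fun (s : ℝ) θ => deriv (circleMap 0 (1 / 2)) θ •
        ((circleMap 0 (1 / 2) θ - 1 / 2) *
        ((1 - circleMap 0 (1 / 2) θ) ^ p / circleMap 0 (1 / 2) θ ^ q *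
          Complex.exp (s * (circleMap 0 (1 / 2) θ - 1 / 2))))) ?_ ?_ ?_ ?_ ?_ ?_).2
    · exact Filter.Eventually.of_forall fun s => (hd.smul (hc s)).aestronglyMeasurable
    · exact (hd.smul (hc t)).intervalIntegrable _ _
    · exact (hd.smul (((continuous_circleMap _ _).sub continuous_const).mul
        (hc t))).aestronglyMeasurable
    · refine Filter.Eventually.of_forall fun θ hθ s hs => hC (s, θ) ⟨?_, ?_⟩
      · rw [Real.ball_eq_Ioo] at hs
        exact ⟨hs.1.le, hs.2.le⟩
      · exact Set.uIoc_subset_uIcc hθ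
    · exact intervalIntegrable_const
    · refine Filter.Eventually.of_forall fun θ _ s _ => ?_
      have h1 : HasDerivAt (fun s : ℝ => Complex.exp (s * (circleMap 0 (1 / 2) θ - 1 / 2)))
          (Complex.exp (s * (circleMap 0 (1 / 2) θ - 1 / 2)) *
            (1 * (circleMap 0 (1 / 2) θ - 1 / 2))) s :=
        ((Complex.ofRealCLM.hasDerivAt (x := s)).mul_const _).cexp
      refine (((h1.const_mul (deriv (circleMap 0 (1 / 2)) θ *
        ((1 - circleMap 0 (1 / 2) θ) ^ p / circleMap 0 (1 / 2) θ ^ q))).congr_deriv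
          ?_)).congr_of_eventuallyEq (Filter.Eventually.of_forall fun s => ?_)
      · simp only [smul_eq_mul]
        ring
      · simp only [smul_eq_mul]
        ring
  refine (key.const_mul (2 * π * Complex.I)⁻¹).congr_deriv ?_
  unfold contour
  have h2 : CircleIntegrable (fun w : ℂ => 1 / 2 *
      ((1 - w) ^ p / w ^ q * Complex.exp (t * (w - 1 / 2)))) 0 (1 / 2) :=
    (continuousOn_const.mul (continuousOn_contour_integrand t p q)).circleIntegrable (by norm_num)
  rw [mul_left_comm, ← mul_sub, ← circleIntegral.integral_const_mul (1 / 2),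
    ← circleIntegral.integral_sub
    ((continuousOn_contour_integrand t p (q - 1)).circleIntegrable (by norm_num)) h2]
  congr 1
  refine circleIntegral.integral_congr (by norm_num) fun w hw => ?_
  have h0 := ne_zero_of_mem_sphere hw
  simp only [zpow_sub_one₀ h0]
  field_simp

/-- Without a pole at `0` the integral vanishes, the other singularity `w = 1` being outside. -/
theorem contour_eq_zero (t : ℝ) (p : ℤ) {q : ℤ} (hq : q ≤ 0) : contour t p q = 0 := by
  unfold contour
  obtain ⟨r, rfl⟩ : ∃ r : ℕ, q = -r := ⟨q.natAbs, by omega⟩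
  have hint : ∀ w : ℂ, (1 - w) ^ p / w ^ (-(r : ℤ)) = (1 - w) ^ p * w ^ r := fun w => by
    rw [zpow_neg, div_inv_eq_mul, zpow_natCast]
  simp only [hint]
  rw [mul_eq_zero]
  right
  refine Complex.circleIntegral_eq_zero_of_differentiable_on_off_countable (by norm_num)
    Set.countable_empty ?_ ?_
  · exact ((((by fun_prop : ContinuousOn (fun w : ℂ => 1 - w) _).zpow₀ p fun w hw =>
        Or.inl (one_sub_ne_zero_of_mem_closedBall hw)).mul (by fun_prop)).mul (by fun_prop))
  · intro w hw
    have h1 := one_sub_ne_zero_of_mem_closedBall (Metric.ball_subset_closedBall hw.1)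
    have h2 : DifferentiableAt ℂ (fun w : ℂ => (1 - w) ^ p) w :=
      (by fun_prop : DifferentiableAt ℂ (fun w : ℂ => 1 - w) w).zpow (Or.inl h1)
    exact (h2.mul (by fun_prop)).mul (by fun_prop)

theorem contour_zero_zero (q : ℤ) : contour 0 0 q = if q = 1 then 1 else 0 := by
  have h : contour 0 0 q = (2 * π * Complex.I)⁻¹ * ∮ w in C(0, 1 / 2), (w - 0) ^ (-q) := by
    simp [contour]
  rw [h]
  split_ifs with hq
  · subst hq
    simp_rw [zpow_neg_one]
    rw [circleIntegral.integral_sub_center_inv _ (by norm_num)]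
    exact inv_mul_cancel₀ Complex.two_pi_I_ne_zero
  · rw [circleIntegral.integral_sub_zpow_of_ne (by omega), mul_zero]

/-- The integral extracts a coefficient beyond the degree of the polynomial `(1 - w)^p`. -/
theorem contour_zero_eq_zero (p : ℕ) {q : ℤ} (hq : p + 1 < q) : contour 0 p q = 0 := by
  induction p generalizing q with
  | zero =>
    rw [Nat.cast_zero, contour_zero_zero, if_neg (by omega)]
  | succ p ih =>
    push_cast at hq ⊢
    rw [contour_succ_left, ih (by omega), ih (by omega), sub_zero]

theorem S_eq_contour (t : ℝ) (n : ℕ) (z x : ℤ) :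
    S t n z x = (2 ^ (x - z))⁻¹ * contour t n (n + 1 + x - z) := by
  unfold S contour
  rw [mul_left_comm _ (2 * π * Complex.I)⁻¹, ← circleIntegral.integral_const_mul ((2 : ℂ) ^ (x - z))⁻¹]
  congr 1
  refine circleIntegral.integral_congr (by norm_num) fun w _ => ?_
  rw [zpow_natCast, div_mul_eq_div_div, div_eq_mul_inv _ ((2 : ℂ) ^ (x - z))]
  ring

theorem Sbar_eq_contour (t : ℝ) (n : ℕ) (z y : ℤ) :
    Sbar t n z y = 2 ^ (y - z) * contour t (y - z + n - 1) n := by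
  unfold Sbar contour
  rw [mul_left_comm _ (2 * π * Complex.I)⁻¹, ← circleIntegral.integral_const_mul ((2 : ℂ) ^ (y - z))]
  congr 1
  refine circleIntegral.integral_congr (by norm_num) fun w _ => ?_
  rw [zpow_natCast, div_mul_eq_div_div, ← neg_sub y z, zpow_neg, div_inv_eq_mul]
  ring

/-! ### Identities for the kernels `S` and `Sbar` -/

theorem S_eq_zero (t : ℝ) (n : ℕ) {z x : ℤ} (h : x + n < z) : S t n z x = 0 := by
  rw [S_eq_contour, contour_eq_zero _ _ (by omega), mul_zero]

theorem S_zero_zero (z x : ℤ) : S 0 0 z x = if z = x then 1 else 0 := by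
  rw [S_eq_contour, Nat.cast_zero, contour_zero_zero]
  by_cases h : z = x
  · subst h
    simp
  · rw [if_neg (by omega), if_neg h, mul_zero]

/-- The kernels `S` in `n` are related by the operator `Q⁻¹`. -/
theorem S_succ (t : ℝ) (n : ℕ) (z x : ℤ) :
    S t (n + 1) z x = 2 * S t n (z - 1) x - S t n z x := by
  simp only [S_eq_contour]
  push_cast
  rw [contour_succ_left, show x - (z - 1) = x - z + 1 by ring, zpow_add_one₀ two_ne_zero,
    show (n : ℤ) + 1 + x - (z - 1) = n + 1 + 1 + x - z by ring,
    show (n : ℤ) + 1 + 1 + x - z - 1 = n + 1 + x - z by ring, mul_inv]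
  ring

theorem hasDerivAt_S (t : ℝ) (n : ℕ) (z x : ℤ) :
    HasDerivAt (fun t => S t n z x) (1 / 2 * (S t n (z + 1) x - S t n z x)) t := by
  simp only [S_eq_contour]
  refine ((hasDerivAt_contour t n (n + 1 + x - z)).const_mul _).congr_deriv ?_
  rw [show x - (z + 1) = x - z - 1 by ring, zpow_sub_one₀ two_ne_zero,
    show (n : ℤ) + 1 + x - (z + 1) = n + 1 + x - z - 1 by ring]
  field_simp

theorem Sbar_zero (t : ℝ) (z y : ℤ) : Sbar t 0 z y = 0 := by
  rw [Sbar_eq_contour, contour_eq_zero _ _ (by simp), mul_zero]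

theorem Sbar_add_one_add_one (t : ℝ) (n : ℕ) (z y : ℤ) :
    Sbar t n (z + 1) (y + 1) = Sbar t n z y := by
  simp only [Sbar_eq_contour]
  congr 2 <;> ring_nf

theorem Sbar_sub_one (t : ℝ) (n : ℕ) (z y : ℤ) : Sbar t n (z - 1) y = Sbar t n z (y + 1) := by
  rw [← Sbar_add_one_add_one, sub_add_cancel]

/-- The analogue for `Sbar` of the recursion `(Q f)(z) = ½ [f(z - 1) + (Q f)(z - 1)]`. -/
theorem Sbar_succ (t : ℝ) (n : ℕ) (z y : ℤ) :
    Sbar t (n + 1) z y = 1 / 2 * (Sbar t n (z - 1) y + Sbar t (n + 1) (z - 1) y) := by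
  simp only [Sbar_eq_contour]
  rw [show y - (z - 1) = y - z + 1 by ring, zpow_add_one₀ two_ne_zero]
  have := contour_succ_left t (y - z + n) (n + 1)
  rw [add_sub_cancel_right] at this
  push_cast
  rw [show y - z + 1 + ((n : ℤ) + 1) - 1 = y - z + n + 1 by ring, this,
    show y - z + 1 + (n : ℤ) - 1 = y - z + n by ring,
    show y - z + ((n : ℤ) + 1) - 1 = y - z + n by ring]
  ring

theorem hasDerivAt_Sbar (t : ℝ) (n : ℕ) (z y : ℤ) :
    HasDerivAt (fun t => Sbar t n z y) (1 / 2 * (Sbar t n z y - Sbar t n z (y + 1))) t := by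
  simp only [Sbar_eq_contour]
  refine ((hasDerivAt_contour t (y - z + n - 1) n).const_mul _).congr_deriv ?_
  rw [show y + 1 - z = y - z + 1 by ring, zpow_add_one₀ two_ne_zero,
    show y - z + 1 + (n : ℤ) - 1 = y - z + n - 1 + 1 by ring, contour_succ_left]
  ring

theorem continuous_Sbar (n : ℕ) (z y : ℤ) : Continuous fun t => Sbar t n z y :=
  continuous_iff_continuousAt.2 fun t => (hasDerivAt_Sbar t n z y).continuousAt

theorem continuous_S (n : ℕ) (z x : ℤ) : Continuous fun t => S t n z x :=
  continuous_iff_continuousAt.2 fun t => (hasDerivAt_S t n z x).continuousAt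

/-- At time `0` and the points `y + 1`, `y`, the kernel `Sbar` has the value of `Q^(n+1)`: the
neighbouring site can be reached by a single step only. -/
theorem Sbar_zero_succ_add_one (n : ℕ) (y : ℤ) :
    Sbar 0 (n + 1) (y + 1) y = if n = 0 then 1 / 2 else 0 := by
  rcases n with - | n
  · rw [Sbar_succ, Sbar_zero, Sbar_eq_contour]
    simp [contour_zero_zero]
  · have h := contour_zero_eq_zero n (q := n + 2) (by omega)
    rw [Sbar_eq_contour]
    push_cast
    rw [show y - (y + 1) + ((n : ℤ) + 1 + 1) - 1 = n by ring,
      show (n : ℤ) + 1 + 1 = n + 2 by ring, h]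
    simp

/-! ### Averaging over one step of the walk -/

/-- The action of `Q` on a function, `(Q f)(z) = ∑_{r ≥ 0} 2^{-(r+1)} f(z - 1 - r)`. It is used for
functions that vanish near `-∞` only, so the sum is finite. -/
def geomAvg (f : ℤ → ℂ) (z : ℤ) : ℂ := ∑' r : ℕ, (1 / 2) ^ (r + 1) * f (z - 1 - r)

theorem geomAvg_eq_sum {f : ℤ → ℂ} {lo : ℤ} (hf : ∀ w ≤ lo, f w = 0) {z : ℤ} {M : ℕ}
    (hM : z ≤ lo + 1 + M) :
    geomAvg f z = ∑ r ∈ Finset.range M, (1 / 2) ^ (r + 1) * f (z - 1 - r) := by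
  refine tsum_eq_sum fun r hr => ?_
  rw [hf _ (by simp only [Finset.mem_range, not_lt] at hr; omega), mul_zero]

theorem geomAvg_add_one {f : ℤ → ℂ} {lo : ℤ} (hf : ∀ w ≤ lo, f w = 0) (z : ℤ) :
    geomAvg f (z + 1) = 1 / 2 * (f z + geomAvg f z) := by
  rw [geomAvg_eq_sum hf (M := (z - lo).toNat + 1) (by omega),
    geomAvg_eq_sum hf (z := z) (M := (z - lo).toNat) (by omega), Finset.sum_range_succ', mul_add,
    Finset.mul_sum, add_comm]
  congr 1
  · simp
  · refine Finset.sum_congr rfl fun r _ => ?_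
    rw [show z + 1 - 1 - ((r + 1 : ℕ) : ℤ) = z - 1 - r by push_cast; ring]
    ring

theorem geomAvg_congr {f g : ℤ → ℂ} {z : ℤ} (h : ∀ w < z, f w = g w) : geomAvg f z = geomAvg g z := by
  refine tsum_congr fun r => ?_
  rw [h _ (by omega)]

theorem geomAvg_eq_zero {f : ℤ → ℂ} {z : ℤ} (h : ∀ w < z, f w = 0) : geomAvg f z = 0 := by
  rw [geomAvg_congr h]
  simp [geomAvg]

theorem geomAvg_mul_const (f : ℤ → ℂ) (c : ℂ) (z : ℤ) :
    geomAvg (fun w => f w * c) z = geomAvg f z * c := by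
  simp only [geomAvg, ← tsum_mul_right, mul_assoc]

theorem geomAvg_sub {f g : ℤ → ℂ} {lo : ℤ} (hf : ∀ w ≤ lo, f w = 0) (hg : ∀ w ≤ lo, g w = 0) (z : ℤ) :
    geomAvg (fun w => f w - g w) z = geomAvg f z - geomAvg g z := by
  have hM : z ≤ lo + 1 + (z - lo).toNat := by omega
  rw [geomAvg_eq_sum hf hM, geomAvg_eq_sum hg hM,
    geomAvg_eq_sum (fun w hw => by rw [hf w hw, hg w hw, sub_zero]) hM, ← Finset.sum_sub_distrib]
  simp only [mul_sub]

theorem geomAvg_finsetSum {ι : Type*} (s : Finset ι) {f : ι → ℤ → ℂ} {lo : ℤ}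
    (hf : ∀ i ∈ s, ∀ w ≤ lo, f i w = 0) (z : ℤ) :
    geomAvg (fun w => ∑ i ∈ s, f i w) z = ∑ i ∈ s, geomAvg (f i) z := by
  have hM : z ≤ lo + 1 + (z - lo).toNat := by omega
  rw [Finset.sum_congr rfl fun i hi => geomAvg_eq_sum (hf i hi) hM,
    geomAvg_eq_sum (fun w hw => Finset.sum_eq_zero fun i hi => hf i hi w hw) hM, Finset.sum_comm]
  simp only [Finset.mul_sum]

theorem norm_geomAvg_le {f : ℤ → ℂ} {lo : ℤ} (hf : ∀ w ≤ lo, f w = 0) {z : ℤ} {C : ℝ} (hC : 0 ≤ C)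
    (h : ∀ w < z, ‖f w‖ ≤ C) : ‖geomAvg f z‖ ≤ C := by
  have key : ∀ M : ℕ, ∑ r ∈ Finset.range M, (1 / 2 : ℝ) ^ (r + 1) * C = (1 - (1 / 2) ^ M) * C := by
    intro M
    induction M with
    | zero => simp
    | succ M ih => rw [Finset.sum_range_succ, ih]; ring
  rw [geomAvg_eq_sum hf (M := (z - lo).toNat) (by omega)]
  calc _ ≤ ∑ r ∈ Finset.range (z - lo).toNat, (1 / 2 : ℝ) ^ (r + 1) * C := by
        refine norm_sum_le_of_le _ fun r _ => ?_
        rw [norm_mul, norm_pow]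
        refine mul_le_mul (by norm_num) (h _ (by omega)) (norm_nonneg _) (by positivity)
    _ = (1 - (1 / 2) ^ (z - lo).toNat) * C := key _
    _ ≤ C := by
        have : (0 : ℝ) ≤ (1 / 2) ^ (z - lo).toNat := by positivity
        nlinarith

/-! ### The hitting kernel by recursion over the first step -/

/-- The kernel `Sepi` for an arbitrary curve `x : ℕ → ℤ`, defined by recursion over the first step
of the walk: `epi t y n x z` is `E_z[Sbar_{n-τ}(B_τ, y); τ < n]`, where `τ` is the first `k` with
`x k < B_k`. -/
def epi (t : ℝ) (y : ℤ) : ℕ → (ℕ → ℤ) → ℤ → ℂ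
  | 0, _, _ => 0
  | n + 1, x, z =>
    if x 0 < z then Sbar t (n + 1) z y else geomAvg (epi t y n fun k => x (k + 1)) z

/-- The curve with its `k`-th point raised by one. -/
def raise (x : ℕ → ℤ) (k : ℕ) : ℕ → ℤ := Function.update x k (x k + 1)

theorem raise_self (x : ℕ → ℤ) (k : ℕ) : raise x k k = x k + 1 := Function.update_self ..

theorem raise_of_ne (x : ℕ → ℤ) {k i : ℕ} (h : i ≠ k) : raise x k i = x i :=
  Function.update_of_ne h ..

theorem le_raise (x : ℕ → ℤ) (k i : ℕ) : x i ≤ raise x k i := by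
  by_cases h : i = k
  · subst h; rw [raise_self]; omega
  · rw [raise_of_ne x h]

theorem raise_zero_tail (x : ℕ → ℤ) : (fun k => raise x 0 (k + 1)) = fun k => x (k + 1) := by
  funext k
  exact raise_of_ne x (by omega)

theorem raise_succ_tail (x : ℕ → ℤ) (k : ℕ) :
    (fun i => raise x (k + 1) (i + 1)) = raise (fun i => x (i + 1)) k := by
  funext i
  by_cases h : i = k
  · subst h; simp only [raise_self]
  · rw [raise_of_ne _ h, raise_of_ne _ (by omega)]

theorem exists_lower_bound (x : ℕ → ℤ) (n : ℕ) : ∃ lo, ∀ k < n, lo ≤ x k := by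
  obtain ⟨lo, h⟩ := ((Set.finite_Iio n).image x).bddBelow
  exact ⟨lo, fun k hk => h ⟨k, hk, rfl⟩⟩

theorem epi_eq_zero (t : ℝ) (y : ℤ) {n : ℕ} {x : ℕ → ℤ} {z : ℤ} (h : ∀ k < n, z ≤ x k) :
    epi t y n x z = 0 := by
  induction n generalizing x z with
  | zero => rfl
  | succ n ih =>
    rw [epi, if_neg (not_lt.2 (h 0 n.succ_pos))]
    exact geomAvg_eq_zero fun w hw => ih fun k hk => hw.le.trans (h (k + 1) (by omega))

theorem epi_congr (t : ℝ) (y : ℤ) {n : ℕ} {x x' : ℕ → ℤ} (h : ∀ k < n, x k = x' k) (z : ℤ) :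
    epi t y n x z = epi t y n x' z := by
  induction n generalizing x x' z with
  | zero => rfl
  | succ n ih =>
    rw [epi, epi, h 0 n.succ_pos]
    congr 1
    exact geomAvg_congr fun w _ => ih (fun k hk => h (k + 1) (by omega)) w

theorem hasDerivAt_epi (t : ℝ) (y : ℤ) (n : ℕ) (x : ℕ → ℤ) (z : ℤ) :
    HasDerivAt (fun t => epi t y n x z) (1 / 2 * (epi t y n x z - epi t (y + 1) n x z)) t := by
  induction n generalizing x z with
  | zero => simpa [epi] using hasDerivAt_const t (0 : ℂ)
  | succ n ih =>
    simp only [epi]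
    split_ifs with hz
    · exact hasDerivAt_Sbar t (n + 1) z y
    · obtain ⟨lo, hlo⟩ := exists_lower_bound (fun k => x (k + 1)) n
      have hM : z ≤ lo + 1 + (z - lo).toNat := by omega
      have h0 : ∀ s y, ∀ w ≤ lo, epi s y n (fun k => x (k + 1)) w = 0 := fun s y w hw =>
        epi_eq_zero s y fun k hk => hw.trans (hlo k hk)
      simp only [geomAvg_eq_sum (h0 _ _) hM]
      refine (HasDerivAt.fun_sum fun (r : ℕ) _ => (ih (fun k => x (k + 1)) (z - 1 - (r : ℤ))).const_mul
        ((1 / 2) ^ (r + 1))).congr_deriv ?_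
      rw [← Finset.sum_sub_distrib, Finset.mul_sum]
      exact Finset.sum_congr rfl fun r _ => by ring

/-- The hitting kernel is bounded uniformly over all curves above a given height. -/
theorem exists_norm_epi_le (T : ℝ) (y : ℤ) (n : ℕ) (lo hi : ℤ) :
    ∃ C : ℝ, 0 ≤ C ∧ ∀ t, 0 ≤ t → t ≤ T → ∀ x : ℕ → ℤ, (∀ k < n, lo ≤ x k) →
      ∀ z ≤ hi, ‖epi t y n x z‖ ≤ C := by
  induction n with
  | zero => exact ⟨0, le_rfl, by simp [epi]⟩
  | succ n ih =>
    obtain ⟨C, hC, h⟩ := ih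
    obtain ⟨C', h'⟩ := (isCompact_Icc (a := (0 : ℝ)) (b := T)).exists_bound_of_continuousOn
      (f := fun t => ∑ z ∈ Finset.Ioc lo hi, ‖Sbar t (n + 1) z y‖)
      (continuous_finsetSum _ fun z _ => (continuous_Sbar (n + 1) z y).norm).continuousOn
    refine ⟨max C C', le_max_of_le_left hC, fun t h0 hT x hx z hz => ?_⟩
    rw [epi]
    split_ifs with hxz
    · refine le_max_of_le_right (le_trans ?_ ((Real.le_norm_self _).trans (h' t ⟨h0, hT⟩)))
      have := hx 0 n.succ_pos
      exact Finset.single_le_sum (f := fun z => ‖Sbar t (n + 1) z y‖) (fun _ _ => norm_nonneg _)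
        (Finset.mem_Ioc.2 ⟨by omega, hz⟩)
    · refine le_max_of_le_left (norm_geomAvg_le (lo := lo) (fun w hw => ?_) hC fun w hw => ?_)
      · exact epi_eq_zero t y fun k hk => hw.trans (hx (k + 1) (by omega))
      · exact h t h0 hT _ (fun k hk => hx (k + 1) (by omega)) w (by omega)

/-! ### Raising one point of the curve -/

theorem epi_raise_zero (t : ℝ) (y : ℤ) (n : ℕ) (x : ℕ → ℤ) {z : ℤ} (hz : z ≠ x 0 + 1) :
    epi t y n (raise x 0) z = epi t y n x z := by
  cases n with
  | zero => rfl
  | succ n =>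
    rw [epi, epi, raise_self, raise_zero_tail]
    by_cases h : x 0 < z
    · rw [if_pos h, if_pos (by omega)]
    · rw [if_neg h, if_neg (by omega)]

/-- Raising a point of the curve by one changes the hitting kernel only on the event that the walk
first hits the curve at the site just above that point, which gives a rank one perturbation. The left factor
does not depend on `t`, `y` and `n`. -/
theorem exists_epi_raise_sub (x : ℕ → ℤ) (k : ℕ) :
    ∃ (u : ℤ → ℂ) (v : ℝ → ℤ → ℕ → ℂ), ∀ t y n z,
      epi t y n (raise x k) z - epi t y n x z = u z * v t y n := by
  induction k generalizing x with
  | zero =>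
    refine ⟨fun z => if z = x 0 + 1 then 1 else 0,
      fun t y n => epi t y n (raise x 0) (x 0 + 1) - epi t y n x (x 0 + 1), fun t y n z => ?_⟩
    by_cases hz : z = x 0 + 1
    · simp only [hz, if_true, one_mul]
    · simp only [if_neg hz]
      rw [epi_raise_zero _ _ _ _ hz, sub_self, zero_mul]
  | succ k ih =>
    obtain ⟨u, v, h⟩ := ih fun i => x (i + 1)
    refine ⟨fun z => if x 0 < z then 0 else geomAvg u z, fun t y n => v t y (n - 1) *
      if n = 0 then 0 else 1, fun t y n z => ?_⟩
    cases n with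
    | zero => simp [epi]
    | succ n =>
      rw [epi, epi, raise_of_ne _ k.succ_ne_zero.symm, raise_succ_tail]
      by_cases hz : x 0 < z
      · simp only [if_pos hz, sub_self, zero_mul]
      · simp only [if_neg hz, n.succ_ne_zero, if_false, Nat.add_sub_cancel]
        obtain ⟨lo, hlo⟩ := exists_lower_bound (fun i => x (i + 1)) n
        have h1 : ∀ w ≤ lo, epi t y n (raise (fun i => x (i + 1)) k) w = 0 := fun w hw =>
          epi_eq_zero t y fun i hi => (hw.trans (hlo i hi)).trans (le_raise _ _ _)
        have h2 : ∀ w ≤ lo, epi t y n (fun i => x (i + 1)) w = 0 := fun w hw =>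
          epi_eq_zero t y fun i hi => hw.trans (hlo i hi)
        rw [← geomAvg_sub h1 h2, mul_one, ← geomAvg_mul_const]
        exact geomAvg_congr fun w _ => h t y n w

/-- Raising the point `k + 1` of the curve has no effect if the point `k` blocks it: a walk that meets
the site just above the former, which is the height of the latter, was above point `k` one step
earlier. -/
theorem epi_raise_of_blocked (t : ℝ) (y : ℤ) (n : ℕ) (x : ℕ → ℤ) (k : ℕ) (h : x k = x (k + 1) + 1)
    (z : ℤ) : epi t y n (raise x (k + 1)) z = epi t y n x z := by
  induction k generalizing n x z with
  | zero =>
    cases n with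
    | zero => rfl
    | succ n =>
      rw [epi, epi, raise_of_ne _ Nat.zero_ne_one, raise_succ_tail]
      split_ifs with hz
      · rfl
      · exact geomAvg_congr fun w hw => epi_raise_zero _ _ _ _ (by omega)
  | succ k ih =>
    cases n with
    | zero => rfl
    | succ n =>
      rw [epi, epi, raise_of_ne _ (by omega), raise_succ_tail]
      congr 1
      exact geomAvg_congr fun w _ => ih n (fun i => x (i + 1)) h w

/-- The hitting kernel satisfies the backward equation: the generator acting on the curve equals
the difference operator that the time derivative produces. -/
theorem sum_epi_raise_sub (t : ℝ) (y : ℤ) (n N : ℕ) (hN : n ≤ N) (x : ℕ → ℤ) (hx : StrictAnti x)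
    (z : ℤ) :
    ∑ k ∈ Finset.range N, (epi t y n (raise x k) z - epi t y n x z)
      = 1 / 2 * (epi t y n x (z - 1) - epi t (y + 1) n x z) := by
  induction n generalizing x N z with
  | zero => simp [epi]
  | succ n ih =>
    obtain ⟨N, rfl⟩ : ∃ M, N = M + 1 := ⟨N - 1, by omega⟩
    have htail : StrictAnti fun i => x (i + 1) := fun i j hij => hx (by omega)
    obtain ⟨lo, hlo⟩ := exists_lower_bound (fun i => x (i + 1)) n
    have hv : ∀ y, ∀ w ≤ lo, epi t y n (fun i => x (i + 1)) w = 0 := fun y w hw =>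
      epi_eq_zero t y fun i hi => hw.trans (hlo i hi)
    rw [Finset.sum_range_succ']
    have hstep : ∀ k, epi t y (n + 1) (raise x (k + 1)) z = if x 0 < z then Sbar t (n + 1) z y else
        geomAvg (epi t y n (raise (fun i => x (i + 1)) k)) z := fun k => by
      rw [epi, raise_of_ne _ k.succ_ne_zero.symm, raise_succ_tail]
    simp only [hstep]
    rcases lt_trichotomy z (x 0 + 1) with hz | hz | hz
    · -- not yet hit: condition on the first step
      rw [epi_raise_zero _ _ _ _ hz.ne, sub_self, add_zero]
      have h1 : ¬ x 0 < z := by omega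
      have hvr : ∀ k, ∀ w ≤ lo, epi t y n (raise (fun i => x (i + 1)) k) w = 0 := fun k w hw =>
        epi_eq_zero t y fun i hi => (hw.trans (hlo i hi)).trans (le_raise _ _ _)
      have h2 : ¬ x 0 < z - 1 := by omega
      simp only [epi, if_neg h1, if_neg h2]
      rw [Finset.sum_congr rfl fun k _ => (geomAvg_sub (hvr k) (hv y) z).symm,
        ← geomAvg_finsetSum _ (lo := lo) (fun k _ w hw => by rw [hvr k w hw, hv y w hw, sub_zero]),
        geomAvg_congr fun w _ => (ih N (by omega) _ htail w).trans (mul_comm _ _),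
        geomAvg_mul_const, geomAvg_sub (lo := lo) (fun w hw => hv y _ (by omega)) (hv (y + 1)),
        mul_comm]
      congr 2
      refine tsum_congr fun r => ?_
      rw [sub_right_comm z 1 (r : ℤ), sub_right_comm (z - 1) 1 (r : ℤ), sub_right_comm z 1 (r : ℤ)]
    · -- only the raising of the first point matters
      subst hz
      have h1 : x 0 < x 0 + 1 := by omega
      have h2 : epi t y n (fun i => x (i + 1)) (x 0) = Sbar t n (x 0) y := by
        cases n with
        | zero => rw [epi, Sbar_zero]
        | succ n => rw [epi, if_pos (hx (by omega))]
      simp only [epi, if_pos h1, sub_self, Finset.sum_const_zero, zero_add, raise_self,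
        raise_zero_tail, lt_irrefl, if_false, add_sub_cancel_right]
      rw [geomAvg_add_one (hv y), h2, Sbar_succ, add_sub_cancel_right, ← Sbar_sub_one,
        add_sub_cancel_right]
      ring
    · have h1 : x 0 < z := by omega
      have h2 : x 0 < z - 1 := by omega
      rw [epi_raise_zero _ _ _ _ hz.ne']
      simp only [epi, if_pos h1, if_pos h2, Sbar_sub_one, sub_self, Finset.sum_const_zero, mul_zero,
        add_zero]

/-! ### The random walk and its first step -/

instance : IsProbabilityMeasure walkLaw := by unfold walkLaw; infer_instance

/-- Prepend a first step to a sequence of steps. -/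
def consStep (p : ℕ × (ℕ → ℕ)) : ℕ → ℕ
  | 0 => p.1
  | k + 1 => p.2 k

theorem measurable_consStep : Measurable consStep := by
  refine measurable_pi_lambda _ fun k => ?_
  cases k with
  | zero => exact measurable_fst
  | succ k => exact (measurable_pi_apply k).comp measurable_snd

/-- The first step of the walk is independent of the remaining ones. -/
theorem map_consStep_walkLaw :
    ((geometricMeasure ⟨1 / 2, by norm_num, by norm_num⟩).prod walkLaw).map consStep = walkLaw := by
  classical
  refine Measure.eq_infinitePi _ fun s t ht => ?_
  obtain ⟨M, hM⟩ := s.exists_nat_subset_range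
  set t' : ℕ → Set ℕ := fun i => if i ∈ s then t i else Set.univ with ht'
  have hpi : Set.pi s t = Set.pi (Finset.range (M + 1)) t' := by
    ext ω
    simp only [Set.mem_pi, Finset.mem_coe, ht']
    refine ⟨fun h i _ => ?_, fun h i hi => ?_⟩
    · split_ifs with hi
      · exact h i hi
      · trivial
    · have := h i (Finset.range_subset_range.2 M.le_succ (hM hi))
      rwa [if_pos hi] at this
  have hpre : consStep ⁻¹' Set.pi s t =
      t' 0 ×ˢ Set.pi (Finset.range M) fun i => t' (i + 1) := by
    rw [hpi]
    ext ⟨r, ω⟩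
    simp only [Set.mem_preimage, Set.mem_pi, Finset.mem_coe, Finset.mem_range, Set.mem_prod]
    refine ⟨fun h => ⟨h 0 (by omega), fun i hi => h (i + 1) (by omega)⟩, fun h i hi => ?_⟩
    cases i with
    | zero => exact h.1
    | succ i => exact h.2 i (by omega)
  rw [Measure.map_apply measurable_consStep (MeasurableSet.pi s.countable_toSet fun i _ => ht i), hpre,
    Measure.prod_prod, walkLaw, Measure.infinitePi_pi _ fun i _ => MeasurableSet.of_discrete,
    mul_comm, ← Finset.prod_range_succ' (fun i => geometricMeasure _ (t' i))]
  rw [← Finset.prod_subset (Finset.Subset.trans hM (Finset.range_subset_range.2 M.le_succ))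
    fun i _ hi => by simp [ht', hi]]
  exact Finset.prod_congr rfl fun i hi => by simp [ht', hi]

/-- The positions of the particles, labelled from `0`. -/
def pos (X : Config) (k : ℕ) : ℤ := X.1 k.succPNat

/-- The hitting time `hitTime` for an arbitrary curve. -/
def hit (x : ℕ → ℤ) (z : ℤ) (ω : ℕ → ℕ) : ℕ∞ := ⨅ (k : ℕ) (_ : x k < walk z ω k), (k : ℕ∞)

theorem walk_succ (z : ℤ) (ω : ℕ → ℕ) (k : ℕ) :
    walk z ω (k + 1) = walk (z - 1 - ω 0) (fun i => ω (i + 1)) k := by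
  unfold walk
  rw [Finset.sum_range_succ']
  ring

theorem hit_of_lt {x : ℕ → ℤ} {z : ℤ} (h : x 0 < z) (ω : ℕ → ℕ) : hit x z ω = 0 :=
  le_antisymm (iInf₂_le 0 (by simpa [walk] using h)) (zero_le)

theorem hit_of_le {x : ℕ → ℤ} {z : ℤ} (h : z ≤ x 0) (ω : ℕ → ℕ) :
    hit x z ω = hit (fun k => x (k + 1)) (z - 1 - ω 0) (fun k => ω (k + 1)) + 1 := by
  refine le_antisymm ?_ (le_iInf₂ fun k hk => ?_)
  · obtain ⟨k, hk⟩ := ENat.exists_eq_iInf fun k : ℕ =>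
      ⨅ (_ : x (k + 1) < walk (z - 1 - ω 0) (fun k => ω (k + 1)) k), (k : ℕ∞)
    rw [hit.eq_def (fun k => x (k + 1)), ← hk]
    by_cases hc : x (k + 1) < walk (z - 1 - ω 0) (fun k => ω (k + 1)) k
    · rw [iInf_pos hc]
      exact iInf₂_le (k + 1) (by rwa [walk_succ])
    · rw [iInf_neg hc, top_add]
      exact le_top
  · cases k with
    | zero => simp [walk] at hk; omega
    | succ k =>
      rw [walk_succ] at hk
      push_cast
      gcongr
      exact iInf₂_le k hk

open Classical in
/-- The random variable whose expectation defines `Sepi`. -/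
def epiSample (t : ℝ) (y : ℤ) (n : ℕ) (x : ℕ → ℤ) (z : ℤ) (ω : ℕ → ℕ) : ℂ :=
  if hit x z ω < n then Sbar t (n - (hit x z ω).toNat) (walk z ω (hit x z ω).toNat) y else 0

theorem epiSample_succ (t : ℝ) (y : ℤ) (n : ℕ) (x : ℕ → ℤ) (z : ℤ) (ω : ℕ → ℕ) :
    epiSample t y (n + 1) x z ω = if x 0 < z then Sbar t (n + 1) z y else
      epiSample t y n (fun k => x (k + 1)) (z - 1 - ω 0) (fun k => ω (k + 1)) := by
  split_ifs with h
  · rw [epiSample, hit_of_lt h]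
    simp [walk]
  · rw [epiSample, epiSample, hit_of_le (not_lt.1 h)]
    set τ := hit (fun k => x (k + 1)) (z - 1 - ω 0) (fun k => ω (k + 1)) with hτ
    clear_value τ
    cases τ with
    | top => simp
    | coe τ =>
      have h1 : (τ : ℕ∞) + 1 = ((τ + 1 : ℕ) : ℕ∞) := by push_cast; rfl
      rw [h1]
      simp only [ENat.toNat_natCast, Nat.cast_lt, Nat.add_lt_add_iff_right, walk_succ,
        Nat.add_sub_add_right]

theorem measurable_epiSample (t : ℝ) (y : ℤ) (n : ℕ) (x : ℕ → ℤ) (z : ℤ) :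
    Measurable (epiSample t y n x z) := by
  induction n generalizing x z with
  | zero =>
    have : epiSample t y 0 x z = fun _ => 0 := by
      funext ω
      simp [epiSample]
    rw [this]
    exact measurable_const
  | succ n ih =>
    have : epiSample t y (n + 1) x z = fun ω => if x 0 < z then Sbar t (n + 1) z y else
      epiSample t y n (fun k => x (k + 1)) (z - 1 - ω 0) (fun k => ω (k + 1)) :=
      funext fun ω => epiSample_succ t y n x z ω
    rw [this]
    split_ifs
    · exact measurable_const
    · have h1 : Measurable fun p : ℕ × (ℕ → ℕ) =>
          epiSample t y n (fun k => x (k + 1)) (z - 1 - p.1) p.2 :=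
        measurable_from_prod_countable_right fun r => ih (fun k => x (k + 1)) (z - 1 - r)
      have h2 : Measurable fun ω : ℕ → ℕ => (ω 0, fun k => ω (k + 1)) :=
        (measurable_pi_apply 0).prodMk (measurable_pi_lambda _ fun k => measurable_pi_apply (k + 1))
      have h3 := h1.comp h2
      rw [Function.comp_def] at h3
      exact h3

theorem exists_norm_epiSample_le (t : ℝ) (y : ℤ) (n : ℕ) (x : ℕ → ℤ) (hi : ℤ) :
    ∃ C : ℝ, ∀ z ≤ hi, ∀ ω, ‖epiSample t y n x z ω‖ ≤ C := by
  induction n generalizing x with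
  | zero => exact ⟨0, by simp [epiSample]⟩
  | succ n ih =>
    obtain ⟨C, h⟩ := ih fun k => x (k + 1)
    refine ⟨max C (∑ z ∈ Finset.Ioc (x 0) hi, ‖Sbar t (n + 1) z y‖), fun z hz ω => ?_⟩
    rw [epiSample_succ]
    split_ifs with hxz
    · exact le_max_of_le_right (Finset.single_le_sum (f := fun z => ‖Sbar t (n + 1) z y‖)
        (fun _ _ => norm_nonneg _) (Finset.mem_Ioc.2 ⟨hxz, hz⟩))
    · exact le_max_of_le_left (h _ (by omega) _)

theorem integral_epiSample (t : ℝ) (y : ℤ) (n : ℕ) (x : ℕ → ℤ) (z : ℤ) :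
    ∫ ω, epiSample t y n x z ω ∂walkLaw = epi t y n x z := by
  induction n generalizing x z with
  | zero => simp [epiSample, epi]
  | succ n ih =>
    rw [epi]
    split_ifs with hz
    · simp [epiSample_succ, hz]
    · have h1 : ∀ p, epiSample t y (n + 1) x z (consStep p) =
          epiSample t y n (fun k => x (k + 1)) (z - 1 - p.1) p.2 := fun p => by
        rw [epiSample_succ, if_neg hz]
        rfl
      obtain ⟨C, hC⟩ := exists_norm_epiSample_le t y (n + 1) x z
      have hp : (⟨1 / 2, by norm_num, by norm_num⟩ : unitInterval) ≠ 0 := by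
        rw [Ne, Subtype.ext_iff]
        norm_num
      rw [← map_consStep_walkLaw, integral_map measurable_consStep.aemeasurable
        (measurable_epiSample t y (n + 1) x z).aestronglyMeasurable, integral_prod]
      · simp only [h1, ih]
        rw [integral_geometricMeasure hp, geomAvg]
        refine tsum_congr fun r => ?_
        rw [Complex.real_smul]
        push_cast
        ring
      · exact Integrable.of_bound ((measurable_epiSample t y (n + 1) x z).comp
          measurable_consStep).aestronglyMeasurable C (Filter.Eventually.of_forall fun p =>
            hC z le_rfl _)

theorem Sepi_eq_epi (X : Config) (t : ℝ) (n : ℕ) (z y : ℤ) :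
    Sepi X t n z y = epi t y n (pos X) z := by
  rw [← integral_epiSample]
  rfl

/-! ### The action of `S` and the kernel `K` -/

theorem tsum_eq_sum_Ioc {f : ℤ → ℂ} {lo hi : ℤ} (h : ∀ z ≤ lo, f z = 0) (h' : ∀ z, hi < z → f z = 0) :
    ∑' z, f z = ∑ z ∈ Finset.Ioc lo hi, f z := by
  refine tsum_eq_sum fun z hz => ?_
  rw [Finset.mem_Ioc, not_and_or, not_lt, not_le] at hz
  exact hz.elim (h z) (h' z)

/-- The adjoint of `S t n` acting on a function. For functions vanishing near `-∞` the sum is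
finite. -/
def actS (t : ℝ) (n : ℕ) (g : ℤ → ℂ) (x : ℤ) : ℂ := ∑' z, S t n z x * g z

theorem K_eq {m : ℕ} (n : Fin m → ℕ+) (X : Config) (t : ℝ) (p q : Fin m × ℤ) :
    K n X t p q = -(if n p.1 < n q.1 then Qpow ((n q.1 : ℕ) - (n p.1 : ℕ)) p.2 q.2 else 0)
      + actS t (n p.1) (epi t q.2 (n q.1) (pos X)) p.2 := by
  simp only [K, comp, actS, Sepi_eq_epi]

theorem actS_eq_sum (t : ℝ) (n : ℕ) {g : ℤ → ℂ} {lo : ℤ} (hg : ∀ w ≤ lo, g w = 0) (x : ℤ) :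
    actS t n g x = ∑ z ∈ Finset.Ioc lo (x + n), S t n z x * g z :=
  tsum_eq_sum_Ioc (fun z hz => by rw [hg z hz, mul_zero])
    fun z hz => by rw [S_eq_zero t n hz, zero_mul]

theorem actS_sub (t : ℝ) (n : ℕ) {f g : ℤ → ℂ} {lo : ℤ} (hf : ∀ w ≤ lo, f w = 0)
    (hg : ∀ w ≤ lo, g w = 0) (x : ℤ) :
    actS t n (fun w => f w - g w) x = actS t n f x - actS t n g x := by
  rw [actS_eq_sum t n hf, actS_eq_sum t n hg, actS_eq_sum t n (fun w hw => by
    rw [hf w hw, hg w hw, sub_zero]), ← Finset.sum_sub_distrib]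
  simp only [mul_sub]

theorem actS_mul_const (t : ℝ) (n : ℕ) (g : ℤ → ℂ) (c : ℂ) (x : ℤ) :
    actS t n (fun w => g w * c) x = actS t n g x * c := by
  simp only [actS, ← tsum_mul_right, mul_assoc]

theorem pos_strictAnti (X : Config) : StrictAnti (pos X) := fun _ _ h =>
  X.2 (Nat.succPNat_lt_succPNat.2 h)

theorem exists_pos_eq_of_not_canJump {X : Config} {i : ℕ} (h : ¬ CanJump X i.succPNat) :
    ∃ j, i = j + 1 ∧ pos X j = pos X (j + 1) + 1 := by
  unfold CanJump at h
  push Not at h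
  obtain ⟨j, hj, h⟩ := h
  have hi : i = j.natPred + 1 := by
    have := congrArg PNat.val hj
    simp only [PNat.add_coe, PNat.one_coe, Nat.succPNat_coe, Nat.succ_eq_add_one] at this
    have h2 := j.natPred_add_one
    omega
  refine ⟨j.natPred, hi, le_antisymm ?_ ?_⟩
  · rw [hi] at h
    have : pos X j.natPred = X.1 j := by rw [pos, PNat.succPNat_natPred]
    rw [this]
    change _ - pos X (j.natPred + 1) ≤ 1 at h
    omega
  · exact pos_strictAnti X (Nat.lt_succ_self _)

theorem pos_jump {X : Config} {i : ℕ} (h : CanJump X i.succPNat) :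
    pos (jump X i.succPNat) = raise (pos X) i := by
  funext k
  rw [jump, dif_pos h]
  unfold pos raise
  by_cases hk : k = i
  · subst hk
    simp
  · rw [Function.update_of_ne hk]
    simp only
    rw [Function.update_of_ne (fun h => hk (Nat.succPNat_injective h))]

theorem epi_jump (t : ℝ) (y : ℤ) (n : ℕ) (X : Config) (i : ℕ) :
    epi t y n (pos (jump X i.succPNat)) = epi t y n (raise (pos X) i) := by
  by_cases h : CanJump X i.succPNat
  · rw [pos_jump h]
  · obtain ⟨j, rfl, hj⟩ := exists_pos_eq_of_not_canJump h
    rw [jump, dif_neg h]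
    exact funext fun z => (epi_raise_of_blocked t y n (pos X) j hj z).symm

theorem exists_epi_jump_eq_zero (X : Config) (n : ℕ) : ∃ lo : ℤ, (∀ t y, ∀ w ≤ lo,
    epi t y n (pos X) w = 0) ∧ ∀ (i : ℕ) t y, ∀ w ≤ lo, epi t y n (pos (jump X i.succPNat)) w = 0 := by
  refine ⟨pos X n, fun t y w hw => epi_eq_zero t y fun k hk =>
    hw.trans ((pos_strictAnti X).antitone hk.le), fun i t y w hw => ?_⟩
  rw [epi_jump]
  exact epi_eq_zero t y fun k hk =>
    (hw.trans ((pos_strictAnti X).antitone hk.le)).trans (le_raise _ _ _)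

theorem hasDerivAt_actS_epi (t : ℝ) (k : ℕ) (y : ℤ) {n N : ℕ} (hN : n ≤ N) (X : Config) (x : ℤ) :
    HasDerivAt (fun t => actS t k (epi t y n (pos X)) x)
      (∑ i ∈ Finset.range N, (actS t k (epi t y n (pos (jump X i.succPNat))) x -
        actS t k (epi t y n (pos X)) x)) t := by
  obtain ⟨lo, h1, h2⟩ := exists_epi_jump_eq_zero X n
  have hgoal : ∑ i ∈ Finset.range N, (actS t k (epi t y n (pos (jump X i.succPNat))) x -
        actS t k (epi t y n (pos X)) x) = ∑ z ∈ Finset.Ioc lo (x + k),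
      S t k z x * (1 / 2 * (epi t y n (pos X) (z - 1) - epi t (y + 1) n (pos X) z)) := by
    simp only [actS_eq_sum t k (h2 _ t y), actS_eq_sum t k (h1 t y), ← Finset.sum_sub_distrib]
    rw [Finset.sum_comm]
    refine Finset.sum_congr rfl fun z _ => ?_
    rw [← sum_epi_raise_sub t y n N hN _ (pos_strictAnti X), Finset.mul_sum]
    simp only [epi_jump, mul_sub]
  -- the shift of the first variable moves from `S` to `epi` by summation by parts
  have hshift : ∑ z ∈ Finset.Ioc lo (x + k), S t k (z + 1) x * epi t y n (pos X) z =
      ∑ z ∈ Finset.Ioc lo (x + k), S t k z x * epi t y n (pos X) (z - 1) := by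
    rw [← tsum_eq_sum_Ioc (f := fun z => S t k (z + 1) x * epi t y n (pos X) z)
        (fun z hz => by rw [h1 t y z hz, mul_zero])
        (fun z hz => by rw [S_eq_zero t k (by omega), zero_mul]),
      ← tsum_eq_sum_Ioc (f := fun z => S t k z x * epi t y n (pos X) (z - 1))
        (fun z hz => by rw [h1 t y _ (by omega), mul_zero])
        (fun z hz => by rw [S_eq_zero t k (by omega), zero_mul]),
      ← (Equiv.addRight (1 : ℤ)).tsum_eq fun z => S t k z x * epi t y n (pos X) (z - 1)]
    simp
  simp only [actS_eq_sum _ k (h1 _ y)]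
  rw [← actS_eq_sum t k (h1 t y), hgoal]
  refine (HasDerivAt.fun_sum fun z _ => (hasDerivAt_S t k z x).mul
    (hasDerivAt_epi t y n (pos X) z)).congr_deriv ?_
  calc _ = ∑ z ∈ Finset.Ioc lo (x + k), (1 / 2 * (S t k (z + 1) x * epi t y n (pos X) z) -
        1 / 2 * (S t k z x * epi t (y + 1) n (pos X) z)) :=
        Finset.sum_congr rfl fun z _ => by ring
    _ = _ := by
        rw [Finset.sum_sub_distrib, ← Finset.mul_sum, hshift, Finset.mul_sum,
          ← Finset.sum_sub_distrib]
        exact Finset.sum_congr rfl fun z _ => by ring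

/-- Every entry of the kernel `K`, as a function of the time and the initial configuration, solves
the backward equation. -/
theorem hasDerivAt_K {m : ℕ} (n : Fin m → ℕ+) {N : ℕ} (hN : ∀ j, (n j : ℕ) ≤ N) (X : Config) (t : ℝ)
    (p q : Fin m × ℤ) :
    HasDerivAt (fun t => K n X t p q)
      (∑ i ∈ Finset.range N, (K n (jump X i.succPNat) t p q - K n X t p q)) t := by
  simp only [K_eq, add_sub_add_left_eq_sub]
  exact (hasDerivAt_actS_epi t (n p.1) q.2 (hN q.1) X p.2).const_add _

/-- A jump of one particle changes `K` by a kernel of rank one. -/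
theorem exists_K_jump_sub {m : ℕ} (n : Fin m → ℕ+) (X : Config) (t : ℝ) (i : ℕ) :
    ∃ u v : Fin m × ℤ → ℂ, ∀ p q, K n (jump X i.succPNat) t p q - K n X t p q = u p * v q := by
  obtain ⟨u, v, h⟩ := exists_epi_raise_sub (pos X) i
  refine ⟨fun p => actS t (n p.1) u p.2, fun q => v t q.2 (n q.1), fun p q => ?_⟩
  obtain ⟨lo, h1, h2⟩ := exists_epi_jump_eq_zero X (n q.1)
  rw [K_eq, K_eq, add_sub_add_left_eq_sub, ← actS_sub t _ (h2 i t q.2) (h1 t q.2),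
    ← actS_mul_const]
  congr 1
  funext w
  rw [epi_jump, h]

theorem K_congr {m : ℕ} (n : Fin m → ℕ+) {N : ℕ} (hN : ∀ j, (n j : ℕ) ≤ N) {X Y : Config}
    (h : ∀ k < N, pos X k = pos Y k) (t : ℝ) : K n X t = K n Y t := by
  funext p q
  rw [K_eq, K_eq]
  congr 2
  exact funext fun z => epi_congr t q.2 (fun k hk => h k (hk.trans_le (hN q.1))) z

theorem exists_norm_K_le {m : ℕ} (n : Fin m → ℕ+) (X₀ : Config) (T : ℝ) (p q : Fin m × ℤ) :
    ∃ C : ℝ, ∀ t, 0 ≤ t → t ≤ T → ∀ X : Config, (∀ k, X₀.1 k ≤ X.1 k) → ‖K n X t p q‖ ≤ C := by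
  set lo := pos X₀ (n q.1) with hlo
  set hi := p.2 + (n p.1 : ℕ) with hhi
  have hx : ∀ X : Config, (∀ k, X₀.1 k ≤ X.1 k) → ∀ k < (n q.1 : ℕ), lo ≤ pos X k := fun X h k hk =>
    ((pos_strictAnti X₀).antitone hk.le).trans (h _)
  obtain ⟨C, hC, h⟩ := exists_norm_epi_le T q.2 (n q.1) lo hi
  obtain ⟨C', h'⟩ := (isCompact_Icc (a := (0 : ℝ)) (b := T)).exists_bound_of_continuousOn
    (f := fun t => ∑ z ∈ Finset.Ioc lo hi, ‖S t (n p.1) z p.2‖ * C)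
    (continuous_finsetSum _ fun z _ => (continuous_S (n p.1) z p.2).norm.mul
      continuous_const).continuousOn
  refine ⟨‖-(if n p.1 < n q.1 then Qpow ((n q.1 : ℕ) - (n p.1 : ℕ)) p.2 q.2 else 0)‖ + C',
    fun t h0 hT X hX => ?_⟩
  rw [K_eq]
  refine (norm_add_le _ _).trans (add_le_add_right (le_trans ?_
    ((Real.le_norm_self _).trans (h' t ⟨h0, hT⟩))) _)
  rw [actS_eq_sum t (n p.1) (lo := lo) fun w hw => epi_eq_zero t q.2 fun k hk =>
    hw.trans (hx X hX k hk)]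
  refine norm_sum_le_of_le _ fun z hz => ?_
  rw [norm_mul]
  exact mul_le_mul_of_nonneg_left (h t h0 hT _ (hx X hX) z (Finset.mem_Ioc.1 hz).2) (norm_nonneg _)

/-! ### The kernel at time zero -/

/-- The inverse of `Q` acting on functions, `(Q⁻¹ g)(z) = 2 g(z + 1) - g(z)`. -/
def invQ (g : ℤ → ℂ) (z : ℤ) : ℂ := 2 * g (z + 1) - g z

theorem invQ_geomAvg {f : ℤ → ℂ} {lo : ℤ} (hf : ∀ w ≤ lo, f w = 0) : invQ (geomAvg f) = f := by
  funext z
  rw [invQ, geomAvg_add_one hf]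
  ring

theorem actS_succ (t : ℝ) (n : ℕ) {g : ℤ → ℂ} {lo : ℤ} (hg : ∀ w ≤ lo, g w = 0) (x : ℤ) :
    actS t (n + 1) g x = actS t n (invQ g) x := by
  have h1 : ∀ w ≤ lo - 1, invQ g w = 0 := fun w hw => by
    rw [invQ, hg w (by omega), hg _ (by omega)]
    ring
  have h2 : ∑ z ∈ Finset.Ioc (lo - 1) (x + n + 1), S t n (z - 1) x * g z =
      ∑ z ∈ Finset.Ioc (lo - 1) (x + n + 1), S t n z x * g (z + 1) := by
    rw [← tsum_eq_sum_Ioc (f := fun z => S t n (z - 1) x * g z)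
        (fun z hz => by rw [hg z (by omega), mul_zero])
        (fun z hz => by rw [S_eq_zero t n (by omega), zero_mul]),
      ← tsum_eq_sum_Ioc (f := fun z => S t n z x * g (z + 1))
        (fun z hz => by rw [hg _ (by omega), mul_zero])
        (fun z hz => by rw [S_eq_zero t n (by omega), zero_mul]),
      ← (Equiv.addRight (1 : ℤ)).tsum_eq fun z => S t n (z - 1) x * g z]
    simp
  rw [actS, actS, tsum_eq_sum_Ioc (lo := lo - 1) (hi := x + n + 1)
      (fun z hz => by rw [hg z (by omega), mul_zero])
      (fun z hz => by rw [S_eq_zero t _ (by push_cast; omega), zero_mul]),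
    tsum_eq_sum_Ioc (lo := lo - 1) (hi := x + n + 1) (fun z hz => by rw [h1 z hz, mul_zero])
      (fun z hz => by rw [S_eq_zero t n (by omega), zero_mul])]
  calc _ = ∑ z ∈ Finset.Ioc (lo - 1) (x + n + 1),
        (2 * (S t n (z - 1) x * g z) - S t n z x * g z) :=
        Finset.sum_congr rfl fun z _ => by rw [S_succ]; ring
    _ = _ := by
        rw [Finset.sum_sub_distrib, ← Finset.mul_sum, h2, Finset.mul_sum, ← Finset.sum_sub_distrib]
        exact Finset.sum_congr rfl fun z _ => by rw [invQ]; ring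

theorem actS_zero (n : ℕ) {g : ℤ → ℂ} {lo : ℤ} (hg : ∀ w ≤ lo, g w = 0) (x : ℤ) :
    actS 0 n g x = invQ^[n] g x := by
  induction n generalizing g lo with
  | zero => simp [actS, S_zero_zero]
  | succ n ih =>
    rw [actS_succ 0 n hg, Function.iterate_succ_apply, ih (lo := lo - 1) fun w hw => by
      rw [invQ, hg w (by omega), hg _ (by omega)]
      ring]

theorem Qpow_zero (x y : ℤ) : Qpow 0 x y = if x = y then 1 else 0 := rfl

theorem Qpow_succ (k : ℕ) (x y : ℤ) : Qpow (k + 1) x y = geomAvg (fun z => Qpow k z y) x := by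
  have hinj : Function.Injective fun r : ℕ => x - 1 - (r : ℤ) := fun a b h => by
    simp only at h
    omega
  rw [Qpow, comp, geomAvg, ← hinj.tsum_eq]
  · refine tsum_congr fun r => ?_
    rw [Q, if_pos (by omega), show x - (x - 1 - r) = ((r + 1 : ℕ) : ℤ) by push_cast; ring,
      zpow_natCast, one_div_pow]
  · intro z hz
    by_cases h : z < x
    · exact ⟨(x - 1 - z).toNat, by simp only; omega⟩
    · simp [Q, h] at hz

theorem Qpow_eq_zero (k : ℕ) {x y : ℤ} (h : x < y + k) : Qpow k x y = 0 := by
  induction k generalizing x with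
  | zero => rw [Qpow_zero, if_neg (by push_cast at h; omega)]
  | succ k ih =>
    rw [Qpow_succ]
    exact geomAvg_eq_zero fun w hw => ih (by push_cast at h; omega)

/-- Far to the left only the powers of `Q` contribute to `K`. -/
theorem K_eq_zero {m : ℕ} (n : Fin m → ℕ+) (X : Config) (t : ℝ) {p q : Fin m × ℤ}
    (hp : p.2 + n p.1 ≤ X.1 (n q.1)) (hpq : n p.1 < n q.1 → p.2 ≤ q.2) : K n X t p q = 0 := by
  have h : ∀ w ≤ X.1 (n q.1), epi t q.2 (n q.1) (pos X) w = 0 := fun w hw =>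
    epi_eq_zero t q.2 fun k hk => hw.trans (X.2.antitone
      (PNat.coe_le_coe _ _ |>.1 (by simp only [Nat.succPNat_coe]; omega)))
  rw [K_eq, actS_eq_sum t _ h, Finset.Ioc_eq_empty (by omega), Finset.sum_empty, add_zero,
    neg_eq_zero]
  split_ifs with hlt
  · have h1 : (n p.1 : ℕ) < n q.1 := hlt
    exact Qpow_eq_zero _ (by have := hpq hlt; omega)
  · rfl

theorem iterate_invQ_Qpow (j k : ℕ) (y : ℤ) :
    invQ^[j] (fun z => Qpow (k + j) z y) = fun z => Qpow k z y := by
  induction j with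
  | zero => rfl
  | succ j ih =>
    rw [Function.iterate_succ_apply]
    have : (fun z => Qpow (k + (j + 1)) z y) = geomAvg fun z => Qpow (k + j) z y :=
      funext fun z => Qpow_succ (k + j) z y
    rw [this, invQ_geomAvg (lo := y - 1) fun w hw => Qpow_eq_zero _ (by omega), ih]

theorem iterate_invQ_eq_zero {g : ℤ → ℂ} (j : ℕ) {x : ℤ} (h : ∀ w, w ≤ x + j → g w = 0) :
    invQ^[j] g x = 0 := by
  induction j generalizing g with
  | zero => exact h x (by simp)
  | succ j ih =>
    rw [Function.iterate_succ_apply]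
    refine ih fun w hw => ?_
    rw [invQ, h _ (by push_cast; omega), h _ (by push_cast; omega)]
    ring

/-- At time `0`, `Sbar` extends the powers of `Q` from `y < z` to all points. -/
theorem Sbar_zero_eq_Qpow (n : ℕ) {z y : ℤ} (h : y < z) : Sbar 0 n z y = Qpow n z y := by
  obtain ⟨d, rfl⟩ : ∃ d : ℕ, z = y + d + 1 := ⟨(z - y - 1).toNat, by omega⟩
  clear h
  cases n with
  | zero => rw [Sbar_zero, Qpow_zero, if_neg (by omega)]
  | succ n =>
    have hv : ∀ n : ℕ, ∀ w ≤ y - 1, Qpow n w y = 0 := fun n w hw => Qpow_eq_zero n (by omega)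
    induction d generalizing n with
    | zero =>
      rw [Nat.cast_zero, add_zero, Sbar_zero_succ_add_one, Qpow_succ, geomAvg_add_one (hv n),
        geomAvg_eq_zero fun w hw => hv n w (by omega)]
      cases n with
      | zero => simp [Qpow]
      | succ n => rw [Qpow_eq_zero _ (by push_cast; omega)]; simp
    | succ d ih =>
      rw [Sbar_succ, Qpow_succ, geomAvg_add_one (hv n), ← Qpow_succ, add_sub_cancel_right]
      push_cast
      rw [← add_assoc, ih]
      congr 2
      cases n with
      | zero => rw [Sbar_zero, Qpow_zero, if_neg (by omega)]
      | succ n => rw [ih]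

/-- A walk at the height `x n` after `n + 1` steps was above `x n` one step earlier, so it has hit the
curve by then, and the hitting condition is no restriction. -/
theorem epi_zero_last {x : ℕ → ℤ} (hx : StrictAnti x) (n : ℕ) (z : ℤ) :
    epi 0 (x n) (n + 1) x z = Qpow (n + 1) z (x n) := by
  induction n generalizing x z with
  | zero =>
    rw [epi]
    split_ifs with h
    · exact Sbar_zero_eq_Qpow _ h
    · rw [geomAvg_eq_zero fun w _ => by rw [epi], Qpow_eq_zero _ (by push_cast; omega)]
  | succ n ih =>
    rw [epi]
    split_ifs with h
    · exact Sbar_zero_eq_Qpow _ ((hx.antitone (Nat.zero_le _)).trans_lt h)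
    · rw [Qpow_succ]
      exact geomAvg_congr fun w _ => ih (x := fun k => x (k + 1)) (fun i j hij => hx (by omega)) w

theorem invQ_epi (t : ℝ) (y : ℤ) (n : ℕ) (x : ℕ → ℤ) {z : ℤ} (hz : z < x 0) :
    invQ (epi t y n x) z = epi t y (n - 1) (fun k => x (k + 1)) z := by
  cases n with
  | zero => simp [invQ, epi]
  | succ n =>
    obtain ⟨lo, hlo⟩ := exists_lower_bound (fun k => x (k + 1)) n
    have h := congrFun (invQ_geomAvg (lo := lo) fun w hw =>
      epi_eq_zero t y (x := fun k => x (k + 1)) (n := n) fun k hk => hw.trans (hlo k hk)) z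
    rw [Nat.add_sub_cancel, ← h, invQ, epi, epi, if_neg (by omega), if_neg (by omega), invQ]

/-- Below the curve, each application of `Q⁻¹` removes one step of the walk. -/
theorem iterate_invQ_epi (t : ℝ) (y : ℤ) (n k : ℕ) {x : ℕ → ℤ} (hx : StrictAnti x) {z : ℤ}
    (hz : z < x k) :
    invQ^[k + 1] (epi t y n x) z = epi t y (n - (k + 1)) (fun i => x (i + (k + 1))) z := by
  induction k generalizing z with
  | zero => exact invQ_epi t y n x hz
  | succ k ih =>
    have h1 : x (k + 1) < x k := hx (Nat.lt_succ_self k)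
    have h2 := invQ_epi t y (n - (k + 1)) (fun i => x (i + (k + 1))) (z := z) (by simpa using hz)
    rw [Function.iterate_succ_apply', invQ, ih (by omega), ih (by omega), ← invQ, h2]
    simp only [Nat.sub_sub, add_assoc, add_comm 1]

theorem K_zero_eq {m : ℕ} (n : Fin m → ℕ+) (X : Config) (p q : Fin m × ℤ) :
    K n X 0 p q = -(if n p.1 < n q.1 then Qpow ((n q.1 : ℕ) - (n p.1 : ℕ)) p.2 q.2 else 0)
      + invQ^[n p.1] (epi 0 q.2 (n q.1) (pos X)) p.2 := by
  rw [K_eq, actS_zero (lo := pos X (n q.1))]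
  exact fun w hw => epi_eq_zero 0 q.2 fun k hk =>
    hw.trans ((pos_strictAnti X).antitone hk.le)

theorem pos_natPred (X : Config) (k : ℕ+) : pos X k.natPred = X.1 k := by
  rw [pos, PNat.succPNat_natPred]

/-- At time `0` the kernel is strictly triangular in the labels to the left of the particles. -/
theorem K_zero_eq_zero {m : ℕ} (n : Fin m → ℕ+) (X : Config) {p q : Fin m × ℤ}
    (hp : p.2 < X.1 (n p.1)) (hpq : n q.1 ≤ n p.1) : K n X 0 p q = 0 := by
  rw [K_zero_eq, if_neg (not_lt.2 hpq), neg_zero, zero_add]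
  have h := iterate_invQ_epi 0 q.2 (n q.1) (n p.1).natPred (pos_strictAnti X) (z := p.2)
    (by rwa [pos_natPred])
  rw [PNat.natPred_add_one] at h
  rw [h, Nat.sub_eq_zero_of_le (by exact_mod_cast hpq), epi]

/-- At time `0` the column of `K` at the position of a particle is a unit vector,
except for entries with a larger label at or to the right of the particle with that label. -/
theorem K_zero_at_particle {m : ℕ} (n : Fin m → ℕ+) (hn : StrictMono n) (X : Config) (j : Fin m)
    (p : Fin m × ℤ) (hp : j < p.1 → p.2 < X.1 (n p.1)) :
    K n X 0 p (j, X.1 (n j)) = if p = (j, X.1 (n j)) then 1 else 0 := by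
  have hlast : epi 0 (X.1 (n j)) (n j) (pos X) = fun z => Qpow (n j) z (X.1 (n j)) := by
    have h := epi_zero_last (pos_strictAnti X) (n j).natPred
    rw [PNat.natPred_add_one, pos_natPred] at h
    exact funext h
  rw [K_zero_eq]
  simp only [hlast]
  rcases lt_trichotomy p.1 j with h | h | h
  · have h1 : ((n p.1 : ℕ+) : ℕ) < n j := hn h
    obtain ⟨d, hd⟩ : ∃ d, (n j : ℕ) = d + n p.1 := ⟨n j - n p.1, by omega⟩
    rw [if_pos (hn h), if_neg (by rintro rfl; exact lt_irrefl _ h), hd, iterate_invQ_Qpow,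
      Nat.add_sub_cancel, neg_add_cancel]
  · have h1 := congrFun (iterate_invQ_Qpow (n j) 0 (X.1 (n j))) p.2
    rw [zero_add] at h1
    rw [h, if_neg (lt_irrefl _), neg_zero, zero_add, h1, Qpow_zero]
    simp only [Prod.ext_iff, h, true_and]
  · have h1 : ((n j : ℕ+) : ℕ) < n p.1 := hn h
    obtain ⟨d, hd⟩ : ∃ d, (n p.1 : ℕ) = d + n j := ⟨n p.1 - n j, by omega⟩
    have h2 : X.1 (n p.1) + d ≤ X.1 (n j) := by
      have h3 : ∀ k d, pos X (k + d) + d ≤ pos X k := fun k d => by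
        induction d with
        | zero => simp
        | succ d ih =>
          have := pos_strictAnti X (Nat.lt_succ_self (k + d))
          push_cast
          rw [← add_assoc k]
          simp only [Nat.succ_eq_add_one] at this
          omega
      have h4 := h3 (n j).natPred d
      have h5 : (n j).natPred + d = (n p.1).natPred := by
        have := (n j).natPred_add_one
        have := (n p.1).natPred_add_one
        omega
      rwa [h5, pos_natPred, pos_natPred] at h4
    have h6 := congrFun (iterate_invQ_Qpow (n j) 0 (X.1 (n j)))
    rw [zero_add] at h6
    rw [if_neg (not_lt.2 (hn h).le), if_neg (by rintro rfl; exact lt_irrefl _ h), neg_zero, zero_add,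
      hd, Function.iterate_add_apply, funext h6]
    refine iterate_invQ_eq_zero d fun w hw => ?_
    have := hp h
    rw [Qpow_zero, if_neg (by omega)]

/-! ### Determinants -/

section Determinants

open Matrix

variable {ι : Type*} [Fintype ι] [DecidableEq ι]

theorem det_updateCol_eq_sum (M : Matrix ι ι ℂ) (j : ι) (v : ι → ℂ) :
    (M.updateCol j v).det = ∑ σ : Equiv.Perm ι, ((Equiv.Perm.sign σ : ℤ) : ℂ) *
      ((∏ i ∈ Finset.univ.erase j, M (σ i) i) * v (σ j)) := by
  rw [det_apply']
  refine Finset.sum_congr rfl fun σ _ => ?_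
  rw [← Finset.prod_erase_mul _ _ (Finset.mem_univ j), updateCol_self]
  congr 2
  exact Finset.prod_congr rfl fun i hi => updateCol_ne (Finset.ne_of_mem_erase hi)

theorem hasDerivAt_det {M : ℝ → Matrix ι ι ℂ} {M' : Matrix ι ι ℂ} {t : ℝ}
    (h : ∀ p q, HasDerivAt (fun t => M t p q) (M' p q) t) :
    HasDerivAt (fun t => (M t).det) (∑ j, ((M t).updateCol j fun i => M' i j).det) t := by
  simp only [det_updateCol_eq_sum]
  simp only [det_apply']
  rw [Finset.sum_comm]
  refine HasDerivAt.fun_sum fun σ _ => ?_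
  rw [← Finset.mul_sum]
  refine HasDerivAt.const_mul _ ?_
  simpa only [smul_eq_mul] using HasDerivAt.fun_finsetProd fun i _ => h (σ i) i

theorem det_add_rankOne (M : Matrix ι ι ℂ) (u v : ι → ℂ) :
    (of fun p q => M p q + u p * v q).det = M.det + ∑ j, v j * (M.updateCol j u).det := by
  -- change the columns one after the other
  have key : ∀ s : Finset ι, (of fun p q => M p q + if q ∈ s then u p * v q else 0).det =
      M.det + ∑ j ∈ s, v j * (M.updateCol j u).det := by
    intro s
    induction s using Finset.induction_on with
    | empty =>
      simp only [Finset.notMem_empty, if_false, add_zero, Finset.sum_empty]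
      rfl
    | insert k s hk ih =>
      set A : Matrix ι ι ℂ := of fun p q => M p q + if q ∈ s then u p * v q else 0 with hA
      have h1 : (of fun p q => M p q + if q ∈ insert k s then u p * v q else 0) =
          A.updateCol k ((fun p => A p k) + v k • u) := by
        ext p q
        by_cases hq : q = k
        · subst hq
          simp [hA, hk, mul_comm]
        · simp [hA, hq]
      have h2 : (A.updateCol k u).det = (M.updateCol k u).det := by
        rw [← det_transpose, ← det_transpose (M.updateCol k u)]
        refine det_eq_of_forall_row_eq_smul_add_const (fun i => if i ∈ s then v i else 0) k
          (if_neg hk) fun i j => ?_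
        by_cases hi : i = k
        · subst hi
          simp [hk]
        · by_cases his : i ∈ s <;> simp [hA, hi, his, mul_comm]
      rw [h1, det_updateCol_add, det_updateCol_smul, h2, Finset.sum_insert hk,
        updateCol_eq_self, ih]
      ring
  simpa using key Finset.univ

/-- If the derivative of a matrix is a sum of finite differences of rank one, then the determinant
inherits this equation from the entries. -/
theorem hasDerivAt_det_of_rankOne {M : ℝ → Matrix ι ι ℂ} {D : ℕ → Matrix ι ι ℂ} {N : ℕ} {t : ℝ}
    (h : ∀ p q, HasDerivAt (fun t => M t p q) (∑ i ∈ Finset.range N, (D i p q - M t p q)) t)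
    (hD : ∀ i, ∃ u v : ι → ℂ, ∀ p q, D i p q - M t p q = u p * v q) :
    HasDerivAt (fun t => (M t).det) (∑ i ∈ Finset.range N, ((D i).det - (M t).det)) t := by
  choose u v huv using hD
  refine (hasDerivAt_det (M' := of fun p q => ∑ i ∈ Finset.range N, u i p * v i q)
    fun p q => (h p q).congr_deriv (Finset.sum_congr rfl fun i _ => huv i p q)).congr_deriv ?_
  have h1 : ∀ i, (D i).det - (M t).det = ∑ j, v i j * ((M t).updateCol j (u i)).det := fun i => by
    have : D i = of fun p q => M t p q + u i p * v i q := by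
      ext p q
      rw [of_apply, ← huv]
      ring
    rw [this, det_add_rankOne, add_sub_cancel_left]
  simp only [h1]
  rw [Finset.sum_comm]
  refine Finset.sum_congr rfl fun j _ => ?_
  simp only [det_updateCol_eq_sum, of_apply, Finset.mul_sum]
  rw [Finset.sum_comm]
  refine Finset.sum_congr rfl fun i _ => Finset.sum_congr rfl fun σ _ => by ring

end Determinants

/-! ### The Fredholm expansion -/

/-- The principal minor of a kernel with the given finite set of rows and columns. -/
def minor {ι : Type*} [DecidableEq ι] (A : ι → ι → ℂ) (s : Finset ι) : ℂ :=
  (Matrix.of fun p q : s => A p q).det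

theorem minor_empty {ι : Type*} [DecidableEq ι] (A : ι → ι → ℂ) : minor A ∅ = 1 :=
  Matrix.det_isEmpty

theorem minor_eq_zero_of_row {ι : Type*} [DecidableEq ι] {A : ι → ι → ℂ} {s : Finset ι} {p : ι}
    (hp : p ∈ s) (h : ∀ q ∈ s, A p q = 0) : minor A s = 0 :=
  Matrix.det_eq_zero_of_row_eq_zero ⟨p, hp⟩ fun q => h q q.2

/-- Adding an index whose column is a unit vector does not change the minor. -/
theorem minor_insert {ι : Type*} [DecidableEq ι] {A : ι → ι → ℂ} {s : Finset ι} {q : ι}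
    (hq : q ∉ s) (h : ∀ p, A p q = if p = q then 1 else 0) : minor A (insert q s) = minor A s := by
  have hu : Subsingleton {i : ↥(insert q s) // (i : ι) = q} :=
    ⟨fun i j => Subtype.ext (Subtype.ext (i.2.trans j.2.symm))⟩
  let e : s ≃ {i : ↥(insert q s) // ¬ (i : ι) = q} :=
    { toFun := fun i => ⟨⟨i, Finset.mem_insert_of_mem i.2⟩, fun h => hq (h ▸ i.2)⟩
      invFun := fun i => ⟨i.1, (Finset.mem_insert.1 i.1.2).resolve_left i.2⟩
      left_inv := fun i => rfl
      right_inv := fun i => rfl }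
  have htri := Matrix.twoBlockTriangular_det (Matrix.of fun p q : ↥(insert q s) => A p q)
    (fun i => (i : ι) = q) fun i hi j hj => by
      rw [Matrix.of_apply, hj, h, if_neg hi]
  refine htri.trans ((congrArg (· * _) (?_ : _ = (1 : ℂ))).trans ?_)
  · refine (Matrix.det_eq_elem_of_subsingleton _ ⟨⟨q, Finset.mem_insert_self q s⟩, rfl⟩).trans ?_
    rw [Matrix.toSquareBlockProp_def, Matrix.of_apply, Matrix.of_apply, h, if_pos rfl]
  · rw [one_mul, ← Matrix.det_submatrix_equiv_self e, minor]
    rfl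

/-- The points between `lo` and the cutoff. -/
def box {m : ℕ} (lo : ℤ) (a : Fin m → ℤ) : Finset (Fin m × ℤ) :=
  Finset.univ.biUnion fun i => (Finset.Ioc lo (a i)).image (Prod.mk i)

theorem mem_box {m : ℕ} {lo : ℤ} {a : Fin m → ℤ} {p : Fin m × ℤ} :
    p ∈ box lo a ↔ lo < p.2 ∧ p.2 ≤ a p.1 := by
  simp only [box, Finset.mem_biUnion, Finset.mem_univ, true_and, Finset.mem_image, Finset.mem_Ioc]
  constructor
  · rintro ⟨i, x, hx, rfl⟩
    exact hx
  · exact fun h => ⟨p.1, p.2, h, rfl⟩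

/-- A minor with an index outside the box vanishes. If there are indices to the left of `lo`, the row
of one with the largest label is zero. -/
theorem minor_cutoff_eq_zero {m : ℕ} {n : Fin m → ℕ+} (hn : StrictMono n) (a : Fin m → ℤ)
    {X : Config} {lo : ℤ} (hlo : ∀ i j, lo + n i ≤ X.1 (n j)) (t : ℝ) {s : Finset (Fin m × ℤ)}
    (hs : ¬ s ⊆ box lo a) : minor (cutoff a (K n X t)) s = 0 := by
  obtain ⟨p, hp, hpb⟩ := Finset.not_subset.1 hs
  rw [mem_box, not_and_or, not_lt] at hpb
  rcases hpb with hpb | hpb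
  · obtain ⟨p, hp, hmax⟩ := (s.filter fun p => p.2 ≤ lo).exists_max_image Prod.fst
      ⟨p, Finset.mem_filter.2 ⟨hp, hpb⟩⟩
    rw [Finset.mem_filter] at hp
    refine minor_eq_zero_of_row hp.1 fun q hq => ?_
    rw [cutoff, K_eq_zero, ite_self]
    · exact (Int.add_le_add_right hp.2 _).trans (hlo _ _)
    · intro h
      by_contra! hqp
      exact ((hmax q (Finset.mem_filter.2 ⟨hq, hqp.le.trans hp.2⟩)).trans_lt (hn.lt_iff_lt.1 h)).false
  · exact minor_eq_zero_of_row hp fun q _ => if_neg fun h => hpb h.1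

/-- The Fredholm determinant of the cutoff TASEP kernel, as the sum of its expansion. -/
def fredholm {m : ℕ} (n : Fin m → ℕ+) (a : Fin m → ℤ) (t : ℝ) (X : Config) : ℂ :=
  ∑' s : Finset (Fin m × ℤ), (-1) ^ s.card * minor (cutoff a (K n X t)) s

theorem fredholm_eq_sum {m : ℕ} {n : Fin m → ℕ+} (hn : StrictMono n) (a : Fin m → ℤ)
    {X : Config} {lo : ℤ} (hlo : ∀ i j, lo + n i ≤ X.1 (n j)) (t : ℝ) :
    fredholm n a t X =
      ∑ s ∈ (box lo a).powerset, (-1) ^ s.card * minor (cutoff a (K n X t)) s := by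
  refine tsum_eq_sum fun s hs => ?_
  rw [minor_cutoff_eq_zero hn a hlo t (fun h => hs (Finset.mem_powerset.2 h)), mul_zero]

/-- The level below which minors vanish; it serves all configurations above `X`. -/
theorem exists_lo {m : ℕ} (n : Fin m → ℕ+) (X : Config) : ∃ lo : ℤ, ∀ i j, lo + n i ≤ X.1 (n j) := by
  obtain ⟨lo, h⟩ := (Set.finite_range fun p : Fin m × Fin m => X.1 (n p.2) - n p.1).bddBelow
  exact ⟨lo, fun i j => by have := h ⟨(i, j), rfl⟩; simp only at this; omega⟩

theorem hasFredholmDet_fredholm {m : ℕ} {n : Fin m → ℕ+} (hn : StrictMono n) (a : Fin m → ℤ)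
    (t : ℝ) (X : Config) : HasFredholmDet (cutoff a (K n X t)) (fredholm n a t X) := by
  obtain ⟨lo, hlo⟩ := exists_lo n X
  rw [fredholm_eq_sum hn a hlo]
  refine hasSum_sum_of_ne_finset_zero fun s hs => ?_
  have := minor_cutoff_eq_zero hn a hlo t (fun h => hs (Finset.mem_powerset.2 h))
  rw [minor] at this
  rw [this, mul_zero]

theorem le_jump (X : Config) (k l : ℕ+) : X.1 l ≤ (jump X k).1 l := by
  unfold jump
  split_ifs
  · by_cases h : l = k
    · subst h
      simp
    · simp [Function.update_of_ne h]
  · rfl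

/-- The Fredholm determinant solves the backward equation, because each of its minors does. -/
theorem hasDerivAt_fredholm {m : ℕ} {n : Fin m → ℕ+} (hn : StrictMono n) (a : Fin m → ℤ)
    {N : ℕ} (hN : ∀ j, (n j : ℕ) ≤ N) (t : ℝ) (X : Config) :
    HasDerivAt (fun t => fredholm n a t X)
      (∑ i ∈ Finset.range N, (fredholm n a t (jump X i.succPNat) - fredholm n a t X)) t := by
  obtain ⟨lo, hlo⟩ := exists_lo n X
  have hlo' : ∀ k i j, lo + n i ≤ (jump X k).1 (n j) := fun k i j => (hlo i j).trans (le_jump _ _ _)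
  simp only [fredholm_eq_sum hn a hlo, fredholm_eq_sum hn a (hlo' _)]
  have hminor : ∀ s : Finset (Fin m × ℤ), HasDerivAt (fun t => minor (cutoff a (K n X t)) s)
      (∑ i ∈ Finset.range N, (minor (cutoff a (K n (jump X i.succPNat) t)) s -
        minor (cutoff a (K n X t)) s)) t := by
    intro s
    refine hasDerivAt_det_of_rankOne (fun p q => ?_) fun i => ?_
    · simp only [Matrix.of_apply, cutoff]
      by_cases h : p.1.2 ≤ a p.1.1 ∧ q.1.2 ≤ a q.1.1
      · simp only [if_pos h]
        exact hasDerivAt_K n hN X t p q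
      · simpa only [if_neg h, sub_self, Finset.sum_const_zero] using hasDerivAt_const t (0 : ℂ)
    · obtain ⟨u, v, h⟩ := exists_K_jump_sub n X t i
      refine ⟨fun p => if p.1.2 ≤ a p.1.1 then u p else 0,
        fun q => if q.1.2 ≤ a q.1.1 then v q else 0, fun p q => ?_⟩
      simp only [Matrix.of_apply, cutoff]
      by_cases hp : p.1.2 ≤ a p.1.1 <;> by_cases hq : q.1.2 ≤ a q.1.1 <;> simp [hp, hq, h]
  refine (HasDerivAt.fun_sum fun s _ => (hminor s).const_mul ((-1) ^ s.card)).congr_deriv ?_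
  simp only [← Finset.sum_sub_distrib, Finset.mul_sum, mul_sub]
  exact Finset.sum_comm

theorem fredholm_congr {m : ℕ} (n : Fin m → ℕ+) (a : Fin m → ℤ) {N : ℕ} (hN : ∀ j, (n j : ℕ) ≤ N)
    {X Y : Config} (h : ∀ k < N, pos X k = pos Y k) (t : ℝ) :
    fredholm n a t X = fredholm n a t Y := by
  simp only [fredholm, K_congr n hN h]

/-- Above a fixed configuration and for bounded times, the Fredholm determinant is bounded, as it is a
sum over the subsets of one finite set. -/
theorem exists_norm_fredholm_le {m : ℕ} {n : Fin m → ℕ+} (hn : StrictMono n) (a : Fin m → ℤ)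
    (X₀ : Config) (T : ℝ) : ∃ C : ℝ, ∀ t, 0 ≤ t → t ≤ T → ∀ X : Config, (∀ k, X₀.1 k ≤ X.1 k) →
      ‖fredholm n a t X‖ ≤ C := by
  obtain ⟨lo, hlo⟩ := exists_lo n X₀
  choose C hC using exists_norm_K_le n X₀ T
  have hC' : ∀ p q, 0 ≤ C p q ∨ T < 0 := fun p q => by
    rcases lt_or_ge T 0 with h | h
    · exact Or.inr h
    · exact Or.inl ((norm_nonneg _).trans (hC p q 0 le_rfl h X₀ fun _ => le_rfl))
  set B := ∑ p ∈ box lo a, ∑ q ∈ box lo a, C p q with hB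
  refine ⟨∑ s ∈ (box lo a).powerset, (Fintype.card s).factorial • B ^ Fintype.card s,
    fun t h0 hT X hX => ?_⟩
  have hCn : ∀ p q, 0 ≤ C p q := fun p q => (hC' p q).resolve_right (by linarith)
  rw [fredholm_eq_sum hn a fun i j => (hlo i j).trans (hX _)]
  refine norm_sum_le_of_le _ fun s hs => ?_
  rw [norm_mul, norm_pow, norm_neg, norm_one, one_pow, one_mul]
  refine Matrix.det_le (abv := NormedField.toAbsoluteValue ℂ) fun p q => ?_
  have hp := Finset.mem_powerset.1 hs p.2
  have hq := Finset.mem_powerset.1 hs q.2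
  have h1 : C p q ≤ B :=
    (Finset.single_le_sum (f := fun q => C p q) (fun q _ => hCn p q) hq).trans
      (Finset.single_le_sum (f := fun p => ∑ q ∈ box lo a, C p q)
        (fun p _ => Finset.sum_nonneg fun q _ => hCn p q) hp)
  change ‖cutoff a (K n X t) p q‖ ≤ B
  unfold cutoff
  split_ifs
  · exact (hC p q t h0 hT X hX).trans h1
  · rw [norm_zero]
    exact (hCn p q).trans h1

open Classical in
/-- The initial condition. -/
theorem fredholm_zero {m : ℕ} {n : Fin m → ℕ+} (hn : StrictMono n) (a : Fin m → ℤ) (X : Config) :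
    fredholm n a 0 X = if ∀ j, a j < X.1 (n j) then 1 else 0 := by
  split_ifs with h
  · rw [fredholm, tsum_eq_single ∅, minor_empty, Finset.card_empty, pow_zero, mul_one]
    intro s hs
    obtain ⟨p, hp, hmax⟩ := s.exists_max_image Prod.fst (Finset.nonempty_iff_ne_empty.2 hs)
    rw [minor_eq_zero_of_row hp, mul_zero]
    intro q hq
    unfold cutoff
    split_ifs with hpq
    · exact K_zero_eq_zero n X (hpq.1.trans_lt (h _)) (hn.monotone (hmax q hq))
    · rfl
  · -- the largest label violating the condition gives a column that cancels the minors in pairs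
    push Not at h
    obtain ⟨j, hj, hmax⟩ := (Finset.univ.filter fun j => X.1 (n j) ≤ a j).exists_max_image id
      (by obtain ⟨j, hj⟩ := h; exact ⟨j, by simpa using hj⟩)
    simp only [Finset.mem_filter, Finset.mem_univ, true_and, id] at hj hmax
    set q : Fin m × ℤ := (j, X.1 (n j)) with hq
    have hcol : ∀ p, cutoff a (K n X 0) p q = if p = q then 1 else 0 := by
      intro p
      unfold cutoff
      by_cases hp : p.2 ≤ a p.1
      · rw [if_pos ⟨hp, hj⟩]
        refine K_zero_at_particle n hn X j p fun hjp => ?_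
        by_contra! hle
        exact (hmax p.1 (hle.trans hp)).not_gt hjp
      · rw [if_neg fun h => hp h.1, if_neg]
        rintro rfl
        exact hp hj
    obtain ⟨lo, hlo⟩ := exists_lo n X
    have hqb : q ∈ box lo a := mem_box.2 ⟨by
      have := hlo j j
      have := (n j).pos
      simp only [hq]
      omega, hj⟩
    rw [fredholm_eq_sum hn a hlo, ← Finset.insert_erase hqb,
      Finset.sum_powerset_insert (Finset.notMem_erase q _), ← Finset.sum_add_distrib]
    refine Finset.sum_eq_zero fun s hs => ?_
    have hqs : q ∉ s := fun h => Finset.notMem_erase q _ (Finset.mem_powerset.1 hs h)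
    rw [minor_insert hqs hcol, Finset.card_insert_of_notMem hqs]
    ring

/-! ### The backward equation on upper sets of configurations -/

/-- A hierarchy `u_k' = u_{k+1}` with `‖u_k‖ ≤ C c^k` on `[0, T]` and initial values bounded by
`A c^k` satisfies `‖u_k‖ ≤ A c^k e^{ct}`, whatever the value of `C`. -/
theorem norm_le_of_hasDeriv_succ {E : Type*} [NormedAddCommGroup E] [NormedSpace ℝ E]
    {u : ℕ → ℝ → E} {T A C c : ℝ} (hA : 0 ≤ A) (hc : 0 ≤ c)
    (hu : ∀ k, ∀ t ∈ Set.Icc 0 T, HasDerivWithinAt (u k) (u (k + 1) t) (Set.Ici 0) t)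
    (hC : ∀ k, ∀ t ∈ Set.Icc 0 T, ‖u k t‖ ≤ C * c ^ k) (h0 : ∀ k, ‖u k 0‖ ≤ A * c ^ k) (k : ℕ) :
    ∀ t ∈ Set.Icc 0 T, ‖u k t‖ ≤ A * c ^ k * Real.exp (c * t) := by
  -- integrating the bound `j` times leaves of `C` only a remainder of order `(ct)^j / j!`
  have key : ∀ (j k : ℕ), ∀ t ∈ Set.Icc 0 T,
      ‖u k t‖ ≤ c ^ k * (A * Real.exp (c * t) + C * ((c * t) ^ j / j.factorial)) := by
    intro j
    induction j with
    | zero =>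
      intro k t ht
      refine (hC k t ht).trans ?_
      rw [pow_zero, Nat.factorial_zero, Nat.cast_one, div_one, mul_one, mul_comm C, mul_add]
      have : 0 ≤ c ^ k * (A * Real.exp (c * t)) := by positivity
      linarith
    | succ j ih =>
      intro k
      refine image_norm_le_of_norm_deriv_right_le_deriv_boundary (f' := fun t => u (k + 1) t)
        (B' := fun t => c ^ (k + 1) * (A * Real.exp (c * t) + C * ((c * t) ^ j / j.factorial)))
        (fun t ht => ((hu k t ht).mono Set.Icc_subset_Ici_self).continuousWithinAt)
        (fun t ht => (hu k t (Set.Ico_subset_Icc_self ht)).mono (Set.Ici_subset_Ici.2 ht.1))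
        ?_ (fun t => ?_) fun t ht => ih (k + 1) t (Set.Ico_subset_Icc_self ht)
      · simpa [mul_comm] using h0 k
      · have h1 : HasDerivAt (fun t => c * t) c t := by
          simpa using (hasDerivAt_id t).const_mul c
        refine (((h1.exp.const_mul A).add (((h1.pow (j + 1)).div_const _).const_mul C)).const_mul
          (c ^ k)).congr_deriv ?_
        have h2 : ((j + 1).factorial : ℝ) = (j + 1) * j.factorial := by
          rw [Nat.factorial_succ]
          push_cast
          ring
        rw [h2, Nat.add_sub_cancel]
        have h3 : (j : ℝ) + 1 ≠ 0 := by positivity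
        have h4 : (j.factorial : ℝ) ≠ 0 := by positivity
        push_cast
        field_simp
        ring
  intro t ht
  have hlim := (((FloorSemiring.tendsto_pow_div_factorial_atTop (c * t)).const_mul C).const_add
    (A * Real.exp (c * t))).const_mul (c ^ k)
  rw [mul_zero, add_zero] at hlim
  refine (ge_of_tendsto' hlim fun j => key j k t ht).trans (le_of_eq (by ring))

/-- The generator of the first `N` particles, for functions with values in any group. -/
def genFin {E : Type*} [AddCommGroup E] (N : ℕ) (f : Config → E) (X : Config) : E :=
  ∑ i ∈ Finset.range N, (f (jump X i.succPNat) - f X)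

theorem norm_iterate_genFin_le {E : Type*} [NormedAddCommGroup E] {N : ℕ} {f : Config → E} {C : ℝ}
    {X₀ : Config} (hf : ∀ X : Config, (∀ k, X₀.1 k ≤ X.1 k) → ‖f X‖ ≤ C) (k : ℕ) :
    ∀ X : Config, (∀ k, X₀.1 k ≤ X.1 k) → ‖(genFin N)^[k] f X‖ ≤ C * (2 * N) ^ k := by
  induction k with
  | zero => simpa using hf
  | succ k ih =>
    intro X hX
    rw [Function.iterate_succ_apply', genFin]
    refine (norm_sum_le_of_le _ fun i _ => (norm_sub_le _ _).trans (add_le_add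
      (ih _ fun l => (hX l).trans (le_jump _ _ _)) (ih X hX))).trans (le_of_eq ?_)
    rw [Finset.sum_const, Finset.card_range, nsmul_eq_mul]
    ring

theorem hasDerivWithinAt_iterate_genFin {E : Type*} [NormedAddCommGroup E] [NormedSpace ℝ E]
    {N : ℕ} {G : ℝ → Config → E} {s : Set ℝ} {t : ℝ}
    (hG : ∀ X, HasDerivWithinAt (fun s => G s X) (genFin N (G t) X) s t) (k : ℕ) (X : Config) :
    HasDerivWithinAt (fun s => (genFin N)^[k] (G s) X) ((genFin N)^[k + 1] (G t) X) s t := by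
  induction k generalizing X with
  | zero => exact hG X
  | succ k ih =>
    have h1 : (fun s => (genFin N)^[k + 1] (G s) X) = fun s => ∑ i ∈ Finset.range N,
        ((genFin N)^[k] (G s) (jump X i.succPNat) - (genFin N)^[k] (G s) X) := by
      funext s
      rw [Function.iterate_succ_apply', genFin]
    rw [h1, Function.iterate_succ_apply', genFin]
    exact HasDerivWithinAt.fun_sum fun i _ => (ih _).sub (ih X)

/-- A solution of the backward equation that is bounded above the configuration `X₀` by some
constant is bounded there in terms of its initial values. -/
theorem norm_le_of_backward {E : Type*} [NormedAddCommGroup E] [NormedSpace ℝ E] {N : ℕ}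
    {G : ℝ → Config → E} {X₀ : Config} {T A C : ℝ} (hA : 0 ≤ A)
    (hG : ∀ t ∈ Set.Icc 0 T, ∀ X,
      HasDerivWithinAt (fun s => G s X) (genFin N (G t) X) (Set.Ici 0) t)
    (hC : ∀ t ∈ Set.Icc 0 T, ∀ X : Config, (∀ k, X₀.1 k ≤ X.1 k) → ‖G t X‖ ≤ C)
    (h0 : ∀ X : Config, (∀ k, X₀.1 k ≤ X.1 k) → ‖G 0 X‖ ≤ A) (hT : 0 ≤ T) :
    ‖G T X₀‖ ≤ A * Real.exp (2 * N * T) := by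
  have h := norm_le_of_hasDeriv_succ (u := fun k t => (genFin N)^[k] (G t) X₀) (T := T) (C := C)
    (c := 2 * N) hA (by positivity)
    (fun k t ht => hasDerivWithinAt_iterate_genFin (hG t ht) k X₀)
    (fun k t ht => norm_iterate_genFin_le (hC t ht) k X₀ fun _ => le_rfl)
    (fun k => norm_iterate_genFin_le h0 k X₀ fun _ => le_rfl) 0 T ⟨hT, le_rfl⟩
  simpa using h

theorem agree_iff (X Y : Config) (N : ℕ+) :
    (∀ k ≤ N, X.1 k = Y.1 k) ↔ ∀ k < (N : ℕ), pos X k = pos Y k := by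
  constructor
  · intro h k hk
    exact h _ ((PNat.coe_le_coe _ _).1 (by simp only [Nat.succPNat_coe]; omega))
  · intro h k hk
    have h1 : (k : ℕ) ≤ N := hk
    have h2 := h k.natPred (by have := k.natPred_add_one; omega)
    rwa [pos_natPred, pos_natPred] at h2

theorem pos_jump_of_ne (X : Config) {i k : ℕ} (h : k ≠ i) : pos (jump X i.succPNat) k = pos X k := by
  by_cases hc : CanJump X i.succPNat
  · rw [pos_jump hc, raise_of_ne _ h]
  · rw [jump, dif_neg hc]

theorem gen_eq_genFin {N : ℕ} {f : Config → ℝ}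
    (hf : ∀ X Y, (∀ k < N, pos X k = pos Y k) → f X = f Y) : gen f = genFin N f := by
  funext X
  rw [gen, genFin, finsum_eq_sum_of_support_subset (s := (Finset.range N).map
    ⟨Nat.succPNat, Nat.succPNat_injective⟩), Finset.sum_map]
  · rfl
  · intro k hk
    rw [Finset.mem_coe, Finset.mem_map]
    refine ⟨k.natPred, ?_, k.succPNat_natPred⟩
    by_contra hkN
    refine hk (sub_eq_zero.2 (hf _ _ fun l hl => ?_))
    rw [← k.succPNat_natPred]
    exact pos_jump_of_ne X (by simp only [Finset.mem_range] at hkN; omega)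

theorem canJump_congr {X Y : Config} {N i : ℕ} (h : ∀ k < N, pos X k = pos Y k) (hi : i < N) :
    CanJump X i.succPNat ↔ CanJump Y i.succPNat := by
  have key : ∀ j : ℕ+, j + 1 = i.succPNat → X.1 j = Y.1 j ∧ X.1 i.succPNat = Y.1 i.succPNat := by
    intro j hj
    refine ⟨?_, h i hi⟩
    have h1 := congrArg PNat.val hj
    simp only [PNat.add_coe, PNat.one_coe, Nat.succPNat_coe, Nat.succ_eq_add_one] at h1
    have h2 := h j.natPred (by have := j.natPred_add_one; omega)
    rwa [pos_natPred, pos_natPred] at h2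
  exact forall₂_congr fun j hj => by rw [(key j hj).1, (key j hj).2]

theorem pos_jump_congr {X Y : Config} {N i : ℕ} (h : ∀ k < N, pos X k = pos Y k) (hi : i < N) :
    ∀ k < N, pos (jump X i.succPNat) k = pos (jump Y i.succPNat) k := by
  intro k hk
  by_cases hki : k = i
  · subst hki
    by_cases hc : CanJump X k.succPNat
    · rw [pos_jump hc, pos_jump ((canJump_congr h hi).1 hc), raise_self, raise_self, h k hk]
    · rw [jump, dif_neg hc, jump, dif_neg fun h' => hc ((canJump_congr h hi).2 h'), h k hk]
  · rw [pos_jump_of_ne X hki, pos_jump_of_ne Y hki, h k hk]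

theorem genFin_congr {N : ℕ} {f : Config → ℝ}
    (hf : ∀ X Y, (∀ k < N, pos X k = pos Y k) → f X = f Y) (X Y : Config)
    (h : ∀ k < N, pos X k = pos Y k) : genFin N f X = genFin N f Y :=
  Finset.sum_congr rfl fun i hi => by
    rw [hf _ _ (pos_jump_congr h (Finset.mem_range.1 hi)), hf X Y h]

theorem hasDerivWithinAt_of_isBackwardSolution {m : ℕ} {n : Fin m → ℕ+} {a : Fin m → ℤ}
    {G : ℝ → Config → ℝ} (hG : IsBackwardSolution n a G) : ∃ N₀ : ℕ, ∀ N ≥ N₀, ∀ t, 0 ≤ t → ∀ X,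
      HasDerivWithinAt (fun s => G s X) (genFin N (G t) X) (Set.Ici 0) t := by
  obtain ⟨N₀, hN₀⟩ := hG.cylinder
  refine ⟨N₀, fun N hN t ht X => ?_⟩
  rw [← gen_eq_genFin fun X Y h => hN₀ t ht X Y ((agree_iff X Y N₀).2 fun k hk =>
    h k (hk.trans_le hN))]
  exact hG.equation t ht X

theorem isBackwardSolution_unique {m : ℕ} {n : Fin m → ℕ+} {a : Fin m → ℤ} {F G : ℝ → Config → ℝ}
    (hF : IsBackwardSolution n a F) (hG : IsBackwardSolution n a G) {t : ℝ} (ht : 0 ≤ t)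
    (X : Config) : G t X = F t X := by
  obtain ⟨N₁, h₁⟩ := hasDerivWithinAt_of_isBackwardSolution hF
  obtain ⟨N₂, h₂⟩ := hasDerivWithinAt_of_isBackwardSolution hG
  obtain ⟨C₁, hC₁⟩ := hF.bounded t
  obtain ⟨C₂, hC₂⟩ := hG.bounded t
  set N := max N₁ N₂
  have h := norm_le_of_backward (N := N) (G := fun t X => G t X - F t X) (X₀ := X) (T := t)
    (A := 0) (C := C₂ + C₁) le_rfl (fun s hs Y => ?_) (fun s hs Y _ => ?_) (fun Y _ => ?_) ht
  · rw [zero_mul, norm_le_zero_iff] at h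
    exact sub_eq_zero.1 h
  · refine ((h₂ N (le_max_right _ _) s hs.1 Y).sub (h₁ N (le_max_left _ _) s hs.1 Y)).congr_deriv ?_
    rw [genFin, genFin, genFin, ← Finset.sum_sub_distrib]
    exact Finset.sum_congr rfl fun i _ => by ring
  · exact (norm_sub_le _ _).trans (add_le_add (hC₂ s hs.1 hs.2 Y) (hC₁ s hs.1 hs.2 Y))
  · rw [hF.initial, hG.initial, sub_self, norm_zero]

/-! ### The Fredholm determinant as the solution -/

theorem exists_label_bound {m : ℕ} (n : Fin m → ℕ+) : ∃ N : ℕ+, ∀ j, (n j : ℕ) ≤ N := by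
  obtain ⟨N, h⟩ := (Set.finite_range n).bddAbove
  exact ⟨N, fun j => h ⟨j, rfl⟩⟩

theorem norm_fredholm_le {m : ℕ} {n : Fin m → ℕ+} (hn : StrictMono n) (a : Fin m → ℤ)
    {N : ℕ} (hN : ∀ j, (n j : ℕ) ≤ N) {t : ℝ} (ht : 0 ≤ t) (X : Config) :
    ‖fredholm n a t X‖ ≤ Real.exp (2 * N * t) := by
  obtain ⟨C, hC⟩ := exists_norm_fredholm_le hn a X t
  rw [← one_mul (Real.exp _)]
  refine norm_le_of_backward (C := C) zero_le_one
    (fun s _ Y => (hasDerivAt_fredholm hn a hN s Y).hasDerivWithinAt)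
    (fun s hs Y hY => hC s hs.1 hs.2 Y hY) (fun Y _ => ?_) ht
  rw [fredholm_zero hn]
  split_ifs <;> simp

theorem im_fredholm {m : ℕ} {n : Fin m → ℕ+} (hn : StrictMono n) (a : Fin m → ℤ) {t : ℝ}
    (ht : 0 ≤ t) (X : Config) : (fredholm n a t X).im = 0 := by
  obtain ⟨N, hN⟩ := exists_label_bound n
  obtain ⟨C, hC⟩ := exists_norm_fredholm_le hn a X t
  have h := norm_le_of_backward (N := N) (G := fun t X => (fredholm n a t X).im) (X₀ := X) (T := t)
    (A := 0) (C := C) le_rfl (fun s _ Y => ?_) (fun s hs Y hY => ?_) (fun Y _ => ?_) ht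
  · rwa [zero_mul, norm_le_zero_iff] at h
  · have h1 := Complex.imCLM.hasFDerivAt.comp_hasDerivAt s (hasDerivAt_fredholm hn a hN s Y)
    refine h1.hasDerivWithinAt.congr_deriv ?_
    simp [genFin]
  · exact (Complex.abs_im_le_norm _).trans (hC s hs.1 hs.2 Y hY)
  · rw [fredholm_zero hn]
    split_ifs <;> simp

theorem isBackwardSolution_fredholm {m : ℕ} {n : Fin m → ℕ+} (hn : StrictMono n) (a : Fin m → ℤ) :
    IsBackwardSolution n a fun t X => (fredholm n a t X).re := by
  obtain ⟨N, hN⟩ := exists_label_bound n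
  have hcyl : ∀ t X Y, (∀ k < (N : ℕ), pos X k = pos Y k) →
      (fredholm n a t X).re = (fredholm n a t Y).re := fun t X Y h => by
    rw [fredholm_congr n a hN h]
  refine ⟨⟨N, fun t _ X Y h => hcyl t X Y ((agree_iff X Y N).1 h)⟩, fun T => ?_, fun t _ X => ?_,
    fun X => ?_⟩
  · refine ⟨Real.exp (2 * N * T), fun t ht hT X => (Complex.abs_re_le_norm _).trans
      ((norm_fredholm_le hn a hN ht X).trans (Real.exp_le_exp.2 ?_))⟩
    gcongr
  · rw [gen_eq_genFin (hcyl t)]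
    have h1 := Complex.reCLM.hasFDerivAt.comp_hasDerivAt t (hasDerivAt_fredholm hn a hN t X)
    refine h1.hasDerivWithinAt.congr_deriv ?_
    simp [genFin]
  · rw [fredholm_zero hn]
    split_ifs <;> simp

/-! ### The process -/

section Evolution

open Filter

theorem measurable_of_cylinder {N : ℕ} {f : Config → ℝ}
    (hf : ∀ X Y, (∀ k < N, pos X k = pos Y k) → f X = f Y) : Measurable f := by
  have h : Function.FactorsThrough f fun (X : Config) (k : Fin N) => pos X k := fun X Y h =>
    hf X Y fun k hk => congrFun h ⟨k, hk⟩
  have h1 : f = Function.extend (fun (X : Config) (k : Fin N) => pos X k) f 0 ∘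
      fun (X : Config) (k : Fin N) => pos X k := funext fun X => (h.extend_apply 0 X).symm
  rw [h1]
  exact Measurable.of_discrete.comp (measurable_pi_lambda _ fun k =>
    (measurable_pi_apply _).comp measurable_subtype_coe)

/-- The next point strictly to the right of `s` on the grid of mesh `1 / (i + 1)`. -/
def gridRight (i : ℕ) (s : ℝ≥0) : ℝ≥0 := (⌊s * (i + 1)⌋₊ + 1) / (i + 1)

theorem tendsto_gridRight (s : ℝ≥0) : Tendsto (fun i => gridRight i s) atTop (𝓝[>] s) := by
  have hpos : ∀ i : ℕ, (0 : ℝ≥0) < i + 1 := fun i => by positivity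
  refine tendsto_nhdsWithin_iff.2 ⟨?_, Eventually.of_forall fun i => ?_⟩
  · refine tendsto_of_tendsto_of_tendsto_of_le_of_le (g := fun _ => s)
      (h := fun i : ℕ => s + 1 / ((i : ℝ≥0) + 1)) tendsto_const_nhds ?_ (fun i => ?_) fun i => ?_
    · simpa using (tendsto_one_div_add_atTop_nhds_zero_nat (𝕜 := ℝ≥0)).const_add s
    · rw [gridRight, le_div_iff₀ (hpos i)]
      exact (Nat.lt_floor_add_one _).le
    · rw [gridRight, div_le_iff₀ (hpos i), add_mul, one_div, inv_mul_cancel₀ (hpos i).ne']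
      gcongr
      exact Nat.floor_le (by positivity)
  · rw [Set.mem_Ioi, gridRight, lt_div_iff₀ (hpos i)]
    exact Nat.lt_floor_add_one _

variable {Ω : Type*} [mΩ : MeasurableSpace Ω] {P : Measure Ω}
  {ℱ : Filtration ℝ≥0 mΩ} {X₀ : Config} {X : ℝ≥0 → Ω → Config}

theorem measurable_uncurry_of_isTASEP (hX : IsTASEP P ℱ X₀ X) {N : ℕ} {f : Config → ℝ}
    (hf : ∀ X Y, (∀ k < N, pos X k = pos Y k) → f X = f Y) :
    Measurable fun p : ℝ≥0 × Ω => f (X p.1 p.2) := by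
  refine measurable_of_tendsto_metrizable (f := fun i (p : ℝ≥0 × Ω) => f (X (gridRight i p.1) p.2))
    (fun i => ?_) (tendsto_pi_nhds.2 fun p => ?_)
  · have h1 : Measurable fun q : ℕ × Ω => f (X (((q.1 : ℝ≥0) + 1) / (i + 1)) q.2) :=
      measurable_from_prod_countable_right fun r => (measurable_of_cylinder hf).comp
        ((hX.adapted (((r : ℝ≥0) + 1) / (i + 1))).mono (ℱ.le _) le_rfl)
    have h2 : Measurable fun p : ℝ≥0 × Ω => (⌊p.1 * (i + 1)⌋₊, p.2) :=
      (Nat.measurable_floor.comp (measurable_fst.mul_const _)).prodMk measurable_snd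
    have h3 := h1.comp h2
    rw [Function.comp_def] at h3
    exact h3
  · have h : ∀ᶠ s in 𝓝[>] p.1, ∀ k ∈ Finset.range N, pos (X s p.2) k = pos (X p.1 p.2) k :=
      (Filter.eventually_all_finset _).2 fun k _ => hX.right_continuous p.2 k.succPNat p.1
    exact tendsto_nhds_of_eventually_eq (((tendsto_gridRight p.1).eventually h).mono fun i hi =>
      hf _ _ fun k hk => hi k (Finset.mem_range.2 hk))

theorem measurable_uncurry_toNNReal_of_isTASEP (hX : IsTASEP P ℱ X₀ X) {N : ℕ} {f : Config → ℝ}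
    (hf : ∀ X Y, (∀ k < N, pos X k = pos Y k) → f X = f Y) :
    Measurable fun p : ℝ × Ω => f (X p.1.toNNReal p.2) :=
  (measurable_uncurry_of_isTASEP hX hf).comp
    ((measurable_real_toNNReal.comp measurable_fst).prodMk measurable_snd)

/-- The expectation of an observable at time `t`. -/
def expect (P : Measure Ω) (X : ℝ≥0 → Ω → Config) (f : Config → ℝ) (t : ℝ) : ℝ :=
  ∫ ω, f (X t.toNNReal ω) ∂P

variable [IsProbabilityMeasure P]

theorem norm_expect_le {f : Config → ℝ} {C : ℝ} (hC : ∀ x, ‖f x‖ ≤ C) (t : ℝ) :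
    ‖expect P X f t‖ ≤ C := by
  refine (norm_integral_le_of_norm_le_const (C := C) (Eventually.of_forall fun ω => hC _)).trans ?_
  simp

theorem intervalIntegrable_expect (hX : IsTASEP P ℱ X₀ X) {N : ℕ} {f : Config → ℝ}
    (hf : ∀ X Y, (∀ k < N, pos X k = pos Y k) → f X = f Y) {C : ℝ} (hC : ∀ x, ‖f x‖ ≤ C) (a b : ℝ) :
    IntervalIntegrable (expect P X f) volume a b := by
  have h2 : StronglyMeasurable (expect P X f) :=
    (measurable_uncurry_toNNReal_of_isTASEP hX hf).stronglyMeasurable.integral_prod_right'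
  refine (intervalIntegrable_const (c := C)).mono_fun h2.aestronglyMeasurable
    (Eventually.of_forall fun t => ?_)
  exact (norm_expect_le hC t).trans (Real.le_norm_self C)

/-- The integrated forward equation, from the martingale property and Fubini's theorem. -/
theorem expect_eq (hX : IsTASEP P ℱ X₀ X) {N : ℕ+} {f : Config → ℝ}
    (hf : ∀ X Y, (∀ k < (N : ℕ), pos X k = pos Y k) → f X = f Y) {C : ℝ} (hC : ∀ x, ‖f x‖ ≤ C)
    {t : ℝ} (ht : 0 ≤ t) :
    expect P X f t = f X₀ + ∫ s in (0 : ℝ)..t, expect P X (genFin N f) s := by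
  have h1 : ∫ ω, (f (X 0 ω) - ∫ s in (0 : ℝ)..0, gen f (X s.toNNReal ω)) ∂P =
      ∫ ω, (f (X t.toNNReal ω) - ∫ s in (0 : ℝ)..t.toNNReal, gen f (X s.toNNReal ω)) ∂P := by
    have hM := hX.martingale f ⟨N, fun X Y h => hf X Y ((agree_iff X Y N).1 h)⟩ ⟨C, hC⟩
    have h := hM.setIntegral_eq (zero_le (a := t.toNNReal)) MeasurableSet.univ
    rw [Measure.restrict_univ] at h
    exact h
  simp only [intervalIntegral.integral_same, sub_zero, Real.coe_toNNReal t ht,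
    gen_eq_genFin hf] at h1
  have h0 : ∫ ω, f (X 0 ω) ∂P = f X₀ := by
    rw [integral_congr_ae (hX.initial.mono fun ω hω => congrArg f hω)]
    simp
  have hgC : ∀ x, ‖genFin N f x‖ ≤ C * (2 * N) := fun x => by
    simpa using norm_iterate_genFin_le (N := N) (X₀ := x) (fun y _ => hC y) 1 x fun _ => le_rfl
  have hjoint := measurable_uncurry_toNNReal_of_isTASEP hX (genFin_congr hf)
  have hint : Integrable (fun p : ℝ × Ω => genFin N f (X p.1.toNNReal p.2))
      ((volume.restrict (Set.Ioc 0 t)).prod P) :=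
    Integrable.of_bound hjoint.aestronglyMeasurable _ (Eventually.of_forall fun p => hgC _)
  have hswap : ∫ ω, (∫ s in (0 : ℝ)..t, genFin N f (X s.toNNReal ω)) ∂P =
      ∫ s in (0 : ℝ)..t, expect P X (genFin N f) s := by
    simp only [intervalIntegral.integral_of_le ht, expect]
    exact (integral_integral_swap hint).symm
  have hi1 : Integrable (fun ω => f (X t.toNNReal ω)) P :=
    Integrable.of_bound ((measurable_of_cylinder hf).comp
      ((hX.adapted _).mono (ℱ.le _) le_rfl)).aestronglyMeasurable C (Eventually.of_forall fun _ => hC _)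
  have hi2 : Integrable (fun ω => ∫ s in (0 : ℝ)..t, genFin N f (X s.toNNReal ω)) P := by
    simp only [intervalIntegral.integral_of_le ht]
    exact hint.integral_prod_right
  rw [integral_sub hi1 hi2, hswap, h0] at h1
  rw [expect]
  linarith

theorem expect_eq_max (hX : IsTASEP P ℱ X₀ X) {N : ℕ+} {f : Config → ℝ}
    (hf : ∀ X Y, (∀ k < (N : ℕ), pos X k = pos Y k) → f X = f Y) {C : ℝ} (hC : ∀ x, ‖f x‖ ≤ C)
    (t : ℝ) :
    expect P X f t = f X₀ + ∫ s in (0 : ℝ)..(max t 0), expect P X (genFin N f) s := by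
  rw [← expect_eq hX hf hC (le_max_right t 0)]
  rcases le_total t 0 with ht | ht
  · rw [max_eq_right ht, expect, expect, Real.toNNReal_of_nonpos ht, Real.toNNReal_zero]
  · rw [max_eq_left ht]

theorem continuous_expect (hX : IsTASEP P ℱ X₀ X) {N : ℕ+} {f : Config → ℝ}
    (hf : ∀ X Y, (∀ k < (N : ℕ), pos X k = pos Y k) → f X = f Y) {C : ℝ} (hC : ∀ x, ‖f x‖ ≤ C) :
    Continuous (expect P X f) := by
  have hgC : ∀ x, ‖genFin N f x‖ ≤ C * (2 * N) := fun x => by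
    simpa using norm_iterate_genFin_le (N := N) (X₀ := x) (fun y _ => hC y) 1 x fun _ => le_rfl
  rw [funext (expect_eq_max hX hf hC)]
  exact continuous_const.add ((intervalIntegral.continuous_primitive
    (intervalIntegrable_expect hX (genFin_congr hf) hgC) 0).comp (by fun_prop))

theorem hasDerivWithinAt_expect (hX : IsTASEP P ℱ X₀ X) {N : ℕ+} {f : Config → ℝ}
    (hf : ∀ X Y, (∀ k < (N : ℕ), pos X k = pos Y k) → f X = f Y) {C : ℝ} (hC : ∀ x, ‖f x‖ ≤ C)
    {t : ℝ} (ht : 0 ≤ t) :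
    HasDerivWithinAt (expect P X f) (expect P X (genFin N f) t) (Set.Ici 0) t := by
  have hgC : ∀ x, ‖genFin N f x‖ ≤ C * (2 * N) := fun x => by
    simpa using norm_iterate_genFin_le (N := N) (X₀ := x) (fun y _ => hC y) 1 x fun _ => le_rfl
  have hc := continuous_expect hX (genFin_congr hf) hgC
  have h1 : HasDerivAt (fun t => f X₀ + ∫ s in (0 : ℝ)..t, expect P X (genFin N f) s)
      (expect P X (genFin N f) t) t :=
    (intervalIntegral.integral_hasDerivAt_right (hc.intervalIntegrable _ _)
      (hc.stronglyMeasurableAtFilter _ _) hc.continuousAt).const_add _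
  exact h1.hasDerivWithinAt.congr (fun s hs => expect_eq hX hf hC hs) (expect_eq hX hf hC ht)

/-- Duality: the one-dimensional law of a solution of the martingale problem is given by any bounded
solution of the backward equation. -/
theorem expect_eq_of_isBackwardSolution {m : ℕ} {n : Fin m → ℕ+} {a : Fin m → ℤ}
    {F : ℝ → Config → ℝ} (hF : IsBackwardSolution n a F) (hX : IsTASEP P ℱ X₀ X) {t : ℝ}
    (ht : 0 ≤ t) : expect P X (F 0) t = F t X₀ := by
  obtain ⟨N₀, hN₀⟩ := hasDerivWithinAt_of_isBackwardSolution hF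
  obtain ⟨N₁, hN₁⟩ := hF.cylinder
  obtain ⟨C, hC⟩ := hF.bounded t
  set N : ℕ+ := max N₁ N₀.succPNat with hN
  have hNN₀ : N₀ ≤ (N : ℕ) := N₀.le_succ.trans (PNat.coe_le_coe _ _ |>.2 (le_max_right N₁ N₀.succPNat))
  have hcyl : ∀ k X Y, (∀ l < (N : ℕ), pos X l = pos Y l) →
      (genFin N)^[k] (F 0) X = (genFin N)^[k] (F 0) Y := by
    intro k
    induction k with
    | zero => exact fun X Y h => hN₁ 0 le_rfl X Y fun l hl =>
        (agree_iff X Y N).2 h l (hl.trans (le_max_left _ _))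
    | succ k ih =>
      rw [Function.iterate_succ_apply']
      exact genFin_congr ih
  have hbd : ∀ s, 0 ≤ s → s ≤ t → ∀ k x, ‖(genFin N)^[k] (F s) x‖ ≤ C * (2 * (N : ℕ)) ^ k :=
    fun s hs hst k x => norm_iterate_genFin_le (X₀ := x) (fun y _ => hC s hs hst y) k x fun _ => le_rfl
  have h := norm_le_of_hasDeriv_succ (T := t) (A := 0) (C := C + C) (c := 2 * (N : ℕ))
    (u := fun k s => expect P X ((genFin N)^[k] (F 0)) s - (genFin N)^[k] (F s) X₀)
    le_rfl (by positivity) (fun k s hs => ?_) (fun k s hs => ?_) (fun k => ?_) 0 t ⟨ht, le_rfl⟩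
  · rw [zero_mul, zero_mul, norm_le_zero_iff] at h
    exact sub_eq_zero.1 h
  · have h1 := hasDerivWithinAt_expect hX (hcyl k) (hbd 0 le_rfl ht k) hs.1
    rw [← Function.iterate_succ_apply' (genFin (N : ℕ)) k] at h1
    exact h1.sub (hasDerivWithinAt_iterate_genFin (hN₀ N hNN₀ s hs.1) k X₀)
  · rw [add_mul]
    exact (norm_sub_le _ _).trans (add_le_add (norm_expect_le (hbd 0 le_rfl ht k) s)
      (hbd s hs.1 hs.2 k X₀))
  · rw [expect_eq hX (hcyl k) (hbd 0 le_rfl ht k) le_rfl, intervalIntegral.integral_same, add_zero,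
      sub_self, norm_zero, zero_mul]

theorem measureReal_eq_of_isBackwardSolution {m : ℕ} {n : Fin m → ℕ+} {a : Fin m → ℤ}
    {F : ℝ → Config → ℝ} (hF : IsBackwardSolution n a F) (hX : IsTASEP P ℱ X₀ X) (t : ℝ≥0) :
    P.real {ω | ∀ j, a j < (X t ω).1 (n j)} = F t X₀ := by
  classical
  have hm : MeasurableSet {x : Config | ∀ j, a j < x.1 (n j)} := by
    simp only [Set.ofPred_forall]
    exact MeasurableSet.iInter fun j => measurableSet_lt measurable_const
      ((measurable_pi_apply _).comp measurable_subtype_coe)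
  have hm' : MeasurableSet {ω | ∀ j, a j < (X t ω).1 (n j)} :=
    ((hX.adapted t).mono (ℱ.le t) le_rfl) hm
  rw [← expect_eq_of_isBackwardSolution hF hX t.coe_nonneg, ← integral_indicator_one hm', expect,
    Real.toNNReal_coe]
  refine integral_congr_ae (Eventually.of_forall fun ω => ?_)
  simp only [hF.initial, Set.indicator_apply, Set.mem_ofPred_eq, Pi.one_apply]

end Evolution

end TASEP

end

theorem mainTheorem1 {m : ℕ} (n : Fin m → ℕ+) (hn : StrictMono n) (a : Fin m → ℤ) :
    ∃ F : ℝ → TASEP.Config → ℝ,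
      TASEP.IsBackwardSolution n a F ∧
      (∀ G : ℝ → TASEP.Config → ℝ, TASEP.IsBackwardSolution n a G →
        ∀ t, 0 ≤ t → ∀ X₀, G t X₀ = F t X₀) ∧
      (∀ t, 0 ≤ t → ∀ X₀,
        TASEP.HasFredholmDet (TASEP.cutoff a (TASEP.K n X₀ t)) (F t X₀ : ℂ)) ∧
      (∀ (Ω : Type*) [mΩ : MeasurableSpace Ω] (P : Measure Ω) [IsProbabilityMeasure P]
        (ℱ : Filtration ℝ≥0 mΩ) (X₀ : TASEP.Config) (X : ℝ≥0 → Ω → TASEP.Config),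
        TASEP.IsTASEP P ℱ X₀ X →
        ∀ t : ℝ≥0, P.real {ω | ∀ j, a j < (X t ω).1 (n j)} = F t X₀) := by
  have hF := TASEP.isBackwardSolution_fredholm hn a
  refine ⟨_, hF, fun G hG t ht X₀ => TASEP.isBackwardSolution_unique hF hG ht X₀,
    fun t ht X₀ => ?_, fun Ω _ P _ ℱ X₀ X hX t =>
      TASEP.measureReal_eq_of_isBackwardSolution hF hX t⟩
  have h : (((TASEP.fredholm n a t X₀).re : ℝ) : ℂ) = TASEP.fredholm n a t X₀ :=
    Complex.ext rfl (TASEP.im_fredholm hn a ht X₀).symm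
  rw [h]
  exact TASEP.hasFredholmDet_fredholm hn a t X₀
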